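/- Let $p,q$ be positive integers with $\frac1p+\frac1q<\frac12$, and let $\mathcal L_{p,q}$ be the regular tiling of the hyperbolic plane by regular $p$-gons, $q$ of which meet at each vertex, with symmetry (Fuchsian) group $\mathcal G_{p,q}=\langle a,b\mid a^p,b^q,(ab)^2\rangle$, where $a$ is the rotation by $2\pi/p$ about the centre of a fundamental face and $b$ the rotation by $2\pi/q$ about a vertex of it. Thus the vertices (respectively faces) form the orbit $\mathcal G_{p,q}/\langle b\rangle$ (respectively $\mathcal G_{p,q}/\langle a\rangle$), and a vertex lies on a face if and only if the corresponding cosets intersect. Let $L_0$ be the set of vertices of the fundamental face and, for $n\ge 0$, let $L_{n+1}$ be the set of vertices, not in $L_0\cup\dots\cup L_n$, of all faces that have a vertex in $L_n$. Every layer $L_n$ is finite; let $a_n^{(p)}=|L_n|$ and let $g_p(z)=\sum_{n\ge 0}a_n^{(p)}z^n$ be the growth series. Put $$\lambda_\pm=\tfrac12\Big(2+p(q-2)-2q\pm\sqrt{(p-2)(q-2)(q(p-2)-2p)}\Big).$$ 1. If $p\ge 4$, then for all $n\ge 0$ $$a_n^{(p)}=c_{p,q}\,\big(C_+\lambda_+^n+C_-\lambda_-^n\big),$$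 where $c_{p,q}=\dfrac{p}{2\sqrt{(p-2)(p(q-2)-2q)}}$ and $C_\pm=\sqrt{(p-2)(p(q-2)-2q)}\mp2\sqrt{q-2}\pm p\sqrt{q-2}$. Moreover $\lambda_\pm$ are exactly the eigenvalues of $T_1=\begin{pmatrix}q-3&q-2\\8-3p-3q+pq&5-2p-3q+pq\end{pmatrix}$. 2. If $p=3$, then $a_0^{(3)}=3$, and for all $n\ge 1$ $$a_n^{(3)}=\tilde C_+\lambda_+^{n-1}+\tilde C_-\lambda_-^{n-1},\qquad \tilde C_\pm=\frac32\left(q-3\pm\frac{(q-5)(q-2)}{\sqrt{(q-6)(q-2)}}\right).$$ Moreover $\lambda_\pm$ are exactly the eigenvalues of $T_2=\begin{pmatrix}1&1\\q-6&q-5\end{pmatrix}$. -/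

import Mathlib

namespace HypLattice

/-- The two generators of the Fuchsian group: `a` is the rotation by `2π/p` about the centre of the
fundamental face, `b` the rotation by `2π/q` about a vertex of that face. -/
inductive Gen : Type
  | a
  | b

/-- The relators `a ^ p`, `b ^ q`, `(a b) ^ 2`. -/
def relators (p q : ℕ) : Set (FreeGroup Gen) :=
  {FreeGroup.of Gen.a ^ p, FreeGroup.of Gen.b ^ q, (FreeGroup.of Gen.a * FreeGroup.of Gen.b) ^ 2}

/-- The Fuchsian group `⟨a, b | a ^ p, b ^ q, (a b) ^ 2⟩`. -/
abbrev FuchsianGroup (p q : ℕ) : Type := PresentedGroup (relators p q)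

/-- The rotation about the centre of the fundamental face. -/
def rotFace (p q : ℕ) : FuchsianGroup p q := PresentedGroup.of Gen.a

/-- The rotation about the base vertex. -/
def rotVertex (p q : ℕ) : FuchsianGroup p q := PresentedGroup.of Gen.b

/-- The vertices of the tiling by `p`-gons meeting `q` at a vertex: the orbit of the base vertex,
whose stabilizer is the cyclic group of rotations about it. -/
abbrev Vertex (p q : ℕ) : Type := FuchsianGroup p q ⧸ Subgroup.zpowers (rotVertex p q)

/-- The faces of the tiling: the orbit of the fundamental face, whose stabilizer is the cyclic group
of rotations about its centre. -/
abbrev Face (p q : ℕ) : Type := FuchsianGroup p q ⧸ Subgroup.zpowers (rotFace p q)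

/-- The fundamental face. -/
def baseFace (p q : ℕ) : Face p q := ((1 : FuchsianGroup p q) : Face p q)

/-- A vertex `v` lies on a face `f` if some group element carries the pair
(base vertex, fundamental face) to `(v, f)`. -/
def Incident {p q : ℕ} (v : Vertex p q) (f : Face p q) : Prop :=
  ∃ g : FuchsianGroup p q, (g : Vertex p q) = v ∧ (g : Face p q) = f

/-- The layers. Layer `0` consists of the vertices of the fundamental face; layer `n + 1` consists of
the vertices of all the faces having a vertex in layer `n`, except those in the layers `0, …, n`. -/
def layer (p q : ℕ) : ℕ → Set (Vertex p q)
  | 0 => {v | Incident v (baseFace p q)}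
  | n + 1 => {w | (∃ v ∈ layer p q n, ∃ f : Face p q, Incident v f ∧ Incident w f) ∧
      ∀ m : ℕ, ∀ _ : m ≤ n, w ∉ layer p q m}

theorem layer_zero (p q : ℕ) : layer p q 0 = {v | Incident v (baseFace p q)} := by
  rw [layer]

theorem layer_succ (p q n : ℕ) :
    layer p q (n + 1) =
      {w | (∃ v ∈ layer p q n, ∃ f : Face p q, Incident v f ∧ Incident w f) ∧
        ∀ m : ℕ, m ≤ n → w ∉ layer p q m} := by
  rw [layer]

/-- The growth series `∑ aₙ zⁿ`, where `aₙ` is the number of vertices in layer `n`. -/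
noncomputable def growthSeries (p q : ℕ) : PowerSeries ℝ :=
  PowerSeries.mk fun n => ((layer p q n).ncard : ℝ)

/-- The transfer matrix of the layer recursion for `p ≥ 4`. -/
def transferMatrix (p q : ℝ) : Matrix (Fin 2) (Fin 2) ℝ :=
  !![q - 3, q - 2; 8 - 3 * p - 3 * q + p * q, 5 - 2 * p - 3 * q + p * q]

/-- The transfer matrix of the layer recursion for `p = 3`. -/
def transferMatrixTri (q : ℝ) : Matrix (Fin 2) (Fin 2) ℝ :=
  !![1, 1; q - 6, q - 5]

noncomputable def lamPlus (p q : ℝ) : ℝ :=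
  1 / 2 * (2 + p * (q - 2) - 2 * q + √((p - 2) * (q - 2) * (q * (p - 2) - 2 * p)))

noncomputable def lamMinus (p q : ℝ) : ℝ :=
  1 / 2 * (2 + p * (q - 2) - 2 * q - √((p - 2) * (q - 2) * (q * (p - 2) - 2 * p)))

noncomputable def cConst (p q : ℝ) : ℝ :=
  p / (2 * √((p - 2) * (p * (q - 2) - 2 * q)))

noncomputable def CPlus (p q : ℝ) : ℝ :=
  √((p - 2) * (p * (q - 2) - 2 * q)) - 2 * √(q - 2) + p * √(q - 2)

noncomputable def CMinus (p q : ℝ) : ℝ :=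
  √((p - 2) * (p * (q - 2) - 2 * q)) + 2 * √(q - 2) - p * √(q - 2)

noncomputable def CTildePlus (q : ℝ) : ℝ :=
  3 / 2 * (q - 3 + (q - 5) * (q - 2) / √((q - 6) * (q - 2)))

noncomputable def CTildeMinus (q : ℝ) : ℝ :=
  3 / 2 * (q - 3 - (q - 5) * (q - 2) / √((q - 6) * (q - 2)))

end HypLattice

/-! Arrange all cells, vertices and faces alike, in concentric levels: the fundamental face has
level -1, its vertices level 0, the further faces at these level 1, and so on. Each edge has four
adjacent cells: two neighbours in one level `m`, one cell of level `m - 1` below and one of level `m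
+ 1` above. A cell with `d` edges has two of them in its own level; the other `d - 2` lie above or
below it. With `N m` the number of edges, equivalently of cells, of level `m`, counting gives
`excess m * N m = N (m + 1) + N (m - 1)` for `m ≥ 1`. Eliminating the odd levels leaves `a (n + 2) =
((p - 2) * (q - 2) - 2) * a (n + 1) - a n`, whose characteristic roots are `λ±`; two initial values
fix the coefficients, and the eigenvalue claims follow from trace and determinant.

The substance is that this picture is the tiling defined by the presentation. Levels are unrolled to
copies of `ℤ`, and darts (an edge with an adjacent cell) carry a quarter turn about the edge and a
rotation about the cell. Darts are labelled by group elements so that rotation about a vertex or a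
face multiplies the label on the right by `b` or `a`; the relators make the labels consistent
(`rotCompat`). Conversely, the rotations of the darts modulo full periods satisfy the relators, so
the group acts (`action`). The action is transitive, and the labels show it to be free
(`classElt_action`). Hence vertex darts modulo periods correspond to group elements, cells to
cosets, and the layers are the even levels (`layer_eq`, `ncard_layer`). -/

namespace HypLattice

/-! ### Incidence functions and periods of the levels -/

/-- The number of edges of a cell of level `m` that are not in level `m`: cells of even level are
vertices, of degree `q`, and cells of odd level are faces, with `p` sides. -/
def excess (p q m : ℕ) : ℤ := if Even m then (q : ℤ) - 2 else (p : ℤ) - 2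

/-- The position, in level `m - 1`, of the cell below the edge `i` of level `m`. -/
noncomputable def cellBelow (p q : ℕ) : ℕ → ℤ → ℤ
  | 0 => fun _ => 0
  | m + 1 => fun k => sInf {i : ℤ | k ≤ excess p q m * i - cellBelow p q m i} - 1

/-- The position, in level `m + 1`, of the cell above the edge `i` of level `m`. -/
noncomputable def cellAbove (p q m : ℕ) (i : ℤ) : ℤ := excess p q m * i - cellBelow p q m i

/-- The number of edges (equivalently, of cells) of level `m`. -/
def period (p q : ℕ) : ℕ → ℤ
  | 0 => p
  | 1 => ((q : ℤ) - 2) * p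
  | m + 2 => excess p q (m + 1) * period p q (m + 1) - period p q m

lemma excess_add_two (p q m : ℕ) : excess p q (m + 2) = excess p q m := by
  simp [excess, Nat.even_add]

/-- The condition `1 / p + 1 / q < 1 / 2`, in integers. -/
def IsHyperbolic (p q : ℕ) : Prop := 3 ≤ p ∧ 3 ≤ q ∧ (4 : ℤ) < ((p : ℤ) - 2) * ((q : ℤ) - 2)

lemma isHyperbolic_of_lt {p q : ℕ} (hp : 0 < p) (hq : 0 < q)
    (hpq : (1 : ℝ) / p + (1 : ℝ) / q < 1 / 2) : IsHyperbolic p q := by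
  have hp' : (0 : ℝ) < p := by exact_mod_cast hp
  have hq' : (0 : ℝ) < q := by exact_mod_cast hq
  rw [div_add_div _ _ hp'.ne' hq'.ne', div_lt_div_iff₀ (by positivity) (by norm_num)] at hpq
  have h : (4 : ℤ) < ((p : ℤ) - 2) * ((q : ℤ) - 2) := by
    have : (4 : ℝ) < ((p : ℝ) - 2) * ((q : ℝ) - 2) := by nlinarith
    exact_mod_cast this
  have hp2 : 2 < p := by
    by_contra! hle
    have h1 : (p : ℤ) - 2 ≤ 0 := by omega
    have h2 : (-1 : ℤ) ≤ (p : ℤ) - 2 := by omega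
    have h3 : (-1 : ℤ) ≤ (q : ℤ) - 2 := by omega
    nlinarith
  have hq2 : 2 < q := by
    by_contra! hle
    have h1 : (q : ℤ) - 2 ≤ 0 := by omega
    have h2 : (1 : ℤ) ≤ (p : ℤ) - 2 := by omega
    nlinarith
  exact ⟨hp2, hq2, h⟩

section
variable {p q : ℕ}

lemma IsHyperbolic.excess_pos (h : IsHyperbolic p q) (m : ℕ) : 1 ≤ excess p q m := by
  obtain ⟨h1, h2, -⟩ := h
  unfold excess
  split_ifs <;> omega

lemma IsHyperbolic.excess_mul (h : IsHyperbolic p q) (m : ℕ) :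
    4 < excess p q m * excess p q (m + 1) := by
  obtain ⟨-, -, h3⟩ := h
  unfold excess
  by_cases hm : Even m
  · rw [if_pos hm, if_neg (by simpa [Nat.even_add_one] using hm)]
    linarith
  · rw [if_neg hm, if_pos (by simpa [Nat.even_add_one] using hm)]
    linarith

/-- Positivity alone does not survive the subtraction in the recursion. The second inequality does:
multiplied by `excess (m + 1)`, and with the product of consecutive excesses above 4, it shows that
the subtracted term is at most half of the other. -/
lemma IsHyperbolic.period_pos_and (h : IsHyperbolic p q) (m : ℕ) :
    0 < period p q m ∧ excess p q m * period p q m ≤ 2 * period p q (m + 1) := by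
  induction m with
  | zero =>
    have hq := h.2.1
    have hp : (0 : ℤ) < p := by have := h.1; omega
    have hq : (0 : ℤ) < (q : ℤ) - 2 := by omega
    refine ⟨hp, ?_⟩
    simp only [period, excess, Even.zero, if_true]
    nlinarith [mul_pos hq hp]
  | succ m ih =>
    obtain ⟨h1, h2⟩ := ih
    have e1 := h.excess_pos m
    have e2 := h.excess_pos (m + 1)
    have e3 := h.excess_mul m
    have h3 : 0 < period p q (m + 1) := by nlinarith
    refine ⟨h3, ?_⟩
    have h4 : 2 * period p q m ≤ excess p q (m + 1) * period p q (m + 1) := by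
      nlinarith [mul_le_mul_of_nonneg_left h2 (by linarith : 0 ≤ excess p q (m + 1)),
        mul_le_mul_of_nonneg_right e3.le h1.le]
    rw [period]
    linarith

lemma IsHyperbolic.period_pos (h : IsHyperbolic p q) (m : ℕ) : 0 < period p q m :=
  (h.period_pos_and m).1

/-- Bounds on the number of edges below a cell. -/
def BelowBound (p q m : ℕ) : Prop :=
  (2 ≤ excess p q m ∧ 2 ≤ excess p q (m + 1) ∧
    ∀ i, cellBelow p q m (i + 1) ≤ cellBelow p q m i + 1) ∨
  (excess p q m = 1 ∧ 5 ≤ excess p q (m + 1) ∧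
    ∀ i, cellBelow p q m (i + 2) ≤ cellBelow p q m i + 1) ∨
  (5 ≤ excess p q m ∧ excess p q (m + 1) = 1 ∧
    ∀ i, cellBelow p q m (i + 1) ≤ cellBelow p q m i + 2)

/-- The properties of level `m` that are carried to the next level. -/
structure LevelRegular (p q m : ℕ) : Prop where
  mono_below : Monotone (cellBelow p q m)
  bound : BelowBound p q m
  above_add_period : ∀ i, cellAbove p q m (i + period p q m) =
    cellAbove p q m i + period p q (m + 1)

/-- The increment of `cellAbove` at `i` is the number of edges above cell `i`: the excess minus the
number of edges below. The bounds make it nonnegative; it can vanish only when the excess is 1. -/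
lemma LevelRegular.mono_above {m : ℕ} (h : LevelRegular p q m) :
    Monotone (cellAbove p q m) := by
  refine monotone_int_of_le_succ fun i => ?_
  have h1 := h.mono_below (show i + 1 ≤ i + 2 by omega)
  unfold cellAbove
  rcases h.bound with ⟨a, -, c⟩ | ⟨a, -, c⟩ | ⟨a, -, c⟩ <;> have := c i <;> nlinarith

lemma LevelRegular.above_add_mul_period {m : ℕ} (h : LevelRegular p q m) (t i : ℤ) :
    cellAbove p q m (i + t * period p q m) = cellAbove p q m i + t * period p q (m + 1) := by
  induction t using Int.induction_on with
  | zero => simp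
  | succ k ih =>
    rw [add_mul, one_mul, ← add_assoc, h.above_add_period, ih]; ring
  | pred k ih =>
    have := h.above_add_period (i + (-(k : ℤ) - 1) * period p q m)
    rw [show i + (-(k : ℤ) - 1) * period p q m + period p q m = i + -(k : ℤ) * period p q m by
      ring, ih] at this
    linarith

/-- The Galois relation between the two incidence functions, on which all later position arguments
rest. Monotonicity and periodicity with positive periods ensure that the infimum defining
`cellBelow` is attained. -/
lemma LevelRegular.below_lt_iff {m : ℕ} (hyp : IsHyperbolic p q) (h : LevelRegular p q m)
    (k i : ℤ) : cellBelow p q (m + 1) k < i ↔ k ≤ cellAbove p q m i := by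
  have hN := hyp.period_pos (m + 1)
  have hM := hyp.period_pos m
  set S := {i : ℤ | k ≤ cellAbove p q m i} with hS
  have hne : S.Nonempty := by
    -- Each period raises `cellAbove` by at least 1, so this many periods reach `k`.
    refine ⟨0 + |k - cellAbove p q m 0| * period p q m, ?_⟩
    rw [hS, Set.mem_ofPred_eq, h.above_add_mul_period]
    nlinarith [le_abs_self (k - cellAbove p q m 0), abs_nonneg (k - cellAbove p q m 0)]
  have hbdd : BddBelow S := by
    refine ⟨0 + (-(|k - cellAbove p q m 0| + 1)) * period p q m, fun j hj => ?_⟩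
    by_contra! hlt
    have h1 := h.mono_above hlt.le
    rw [h.above_add_mul_period] at h1
    have h2 : k ≤ cellAbove p q m j := hj
    nlinarith [neg_abs_le (k - cellAbove p q m 0), abs_nonneg (k - cellAbove p q m 0)]
  have hdef : cellBelow p q (m + 1) k = sInf S - 1 := by rw [cellBelow]; rfl
  have hmem : sInf S ∈ S := Int.csInf_mem hne hbdd
  rw [hdef]
  constructor
  · intro hlt
    exact le_trans (show k ≤ cellAbove p q m (sInf S) from hmem) (h.mono_above (by omega))
  · intro hk
    have := csInf_le hbdd (show i ∈ S from hk)
    omega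

lemma levelRegular_zero (hyp : IsHyperbolic p q) : LevelRegular p q 0 where
  mono_below := fun _ _ _ => le_rfl
  bound := by
    obtain ⟨h1, h2, h3⟩ := hyp
    have hp : (1 : ℤ) ≤ (p : ℤ) - 2 := by omega
    have hq : (1 : ℤ) ≤ (q : ℤ) - 2 := by omega
    simp only [BelowBound, excess, cellBelow, Even.zero, if_true, zero_add, Nat.not_even_one,
      if_false]
    rcases hp.eq_or_lt with hp | hp
    · right; right
      rw [← hp] at h3
      exact ⟨by linarith, hp.symm, fun _ => by norm_num⟩
    rcases hq.eq_or_lt with hq | hq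
    · right; left
      rw [← hq] at h3
      exact ⟨hq.symm, by linarith, fun _ => by norm_num⟩
    · left
      exact ⟨by linarith, by linarith, fun _ => by norm_num⟩
  above_add_period := fun i => by
    simp [cellAbove, cellBelow, excess, period]
    ring

/-- By the Galois relation, if `t` consecutive cells of level `m` have at least `s` edges above
them, then `s` consecutive cells of level `m + 1` have at most `t` edges below them. When both
excesses are at least 2 the bound reproduces itself; when one is 1, the other two bounds alternate.
-/
lemma LevelRegular.succ {m : ℕ} (hyp : IsHyperbolic p q) (h : LevelRegular p q m) :
    LevelRegular p q (m + 1) where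
  mono_below := fun k l hkl => by
    have h1 := (h.below_lt_iff hyp l (cellBelow p q (m + 1) l + 1)).1 (by omega)
    have h2 := (h.below_lt_iff hyp k (cellBelow p q (m + 1) l + 1)).2 (by omega)
    omega
  bound := by
    have key : ∀ (k s t : ℤ), (∀ i, cellAbove p q m i + s ≤ cellAbove p q m (i + t)) →
        cellBelow p q (m + 1) (k + s) ≤ cellBelow p q (m + 1) k + t := by
      intro k s t hst
      have h1 := (h.below_lt_iff hyp k (cellBelow p q (m + 1) k + 1)).1 (by omega)
      have h2 := hst (cellBelow p q (m + 1) k + 1)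
      have h3 := (h.below_lt_iff hyp (k + s) (cellBelow p q (m + 1) k + 1 + t)).2 (by omega)
      omega
    rcases h.bound with ⟨a, b, c⟩ | ⟨a, b, c⟩ | ⟨a, b, c⟩
    · left
      refine ⟨b, by rwa [excess_add_two], fun k => key k 1 1 fun i => ?_⟩
      have := c i
      unfold cellAbove
      linarith
    · right; right
      refine ⟨b, by rwa [excess_add_two], fun k => key k 1 2 fun i => ?_⟩
      have := c i
      unfold cellAbove
      rw [a]; linarith
    · right; left
      refine ⟨b, by rwa [excess_add_two], fun k => key k 2 1 fun i => ?_⟩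
      have := c i
      unfold cellAbove
      linarith
  above_add_period := fun k => by
    have key : cellBelow p q (m + 1) (k + period p q (m + 1)) =
        cellBelow p q (m + 1) k + period p q m := by
      have iff : ∀ i, cellBelow p q (m + 1) (k + period p q (m + 1)) < i ↔
          cellBelow p q (m + 1) k < i - period p q m := by
        intro i
        rw [h.below_lt_iff hyp, h.below_lt_iff hyp]
        have := h.above_add_period (i - period p q m)
        rw [sub_add_cancel] at this
        omega
      have h1 := (iff (cellBelow p q (m + 1) (k + period p q (m + 1)) + 1)).1 (by omega)
      have h2 := (iff (cellBelow p q (m + 1) k + period p q m + 1)).2 (by omega)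
      omega
    unfold cellAbove
    rw [key, period]
    ring

lemma IsHyperbolic.levelRegular (hyp : IsHyperbolic p q) (m : ℕ) : LevelRegular p q m := by
  induction m with
  | zero => exact levelRegular_zero hyp
  | succ m ih => exact ih.succ hyp

lemma IsHyperbolic.below_lt_iff (hyp : IsHyperbolic p q) (m : ℕ) (k i : ℤ) :
    cellBelow p q (m + 1) k < i ↔ k ≤ cellAbove p q m i :=
  (hyp.levelRegular m).below_lt_iff hyp k i

lemma IsHyperbolic.le_above_below (hyp : IsHyperbolic p q) (m : ℕ) (k : ℤ) :
    k ≤ cellAbove p q m (cellBelow p q (m + 1) k + 1) :=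
  (hyp.below_lt_iff m k _).1 (by omega)

lemma IsHyperbolic.above_below_lt (hyp : IsHyperbolic p q) (m : ℕ) (k : ℤ) :
    cellAbove p q m (cellBelow p q (m + 1) k) < k := by
  by_contra! h
  exact lt_irrefl _ ((hyp.below_lt_iff m k _).2 h)

end

/-! ### Darts of the unrolled tiling and their rotations -/

/-- The four cells adjacent to an edge. -/
inductive Side : Type
  | right
  | up
  | left
  | down

/-- An edge together with an adjacent cell. -/
structure Dart : Type where
  level : ℕ
  pos : ℤ
  side : Side

namespace Dart

/-- The quarter turn about the midpoint of an edge. -/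
def turn : Equiv.Perm Dart where
  toFun
    | ⟨m, i, .right⟩ => ⟨m, i, .up⟩
    | ⟨m, i, .up⟩ => ⟨m, i, .left⟩
    | ⟨m, i, .left⟩ => ⟨m, i, .down⟩
    | ⟨m, i, .down⟩ => ⟨m, i, .right⟩
  invFun
    | ⟨m, i, .up⟩ => ⟨m, i, .right⟩
    | ⟨m, i, .left⟩ => ⟨m, i, .up⟩
    | ⟨m, i, .down⟩ => ⟨m, i, .left⟩
    | ⟨m, i, .right⟩ => ⟨m, i, .down⟩
  left_inv := by rintro ⟨m, i, _ | _ | _ | _⟩ <;> rfl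
  right_inv := by rintro ⟨m, i, _ | _ | _ | _⟩ <;> rfl

/-- A dart marks a quadrant at its edge; this passes to the other edge at the same corner. -/
noncomputable def corner (p q : ℕ) : Dart → Dart
  | ⟨m, i, .up⟩ =>
    if cellAbove p q m i < cellAbove p q m (i + 1) then ⟨m + 1, cellAbove p q m i + 1, .down⟩
    else ⟨m, i + 1, .left⟩
  | ⟨m, i, .left⟩ =>
    if cellAbove p q m (i - 1) < cellAbove p q m i then ⟨m + 1, cellAbove p q m i, .right⟩
    else ⟨m, i - 1, .up⟩
  | ⟨m, i, .right⟩ =>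
    if cellBelow p q m i < cellBelow p q m (i + 1) then ⟨m - 1, cellBelow p q m i + 1, .left⟩
    else ⟨m, i + 1, .down⟩
  | ⟨m, i, .down⟩ =>
    if cellBelow p q m (i - 1) < cellBelow p q m i then ⟨m - 1, cellBelow p q m i, .up⟩
    else ⟨m, i - 1, .right⟩

/-- The level of the cell of a dart, raised by one: the fundamental face has level `0`. -/
def cellLevel : Dart → ℕ
  | ⟨m, _, .right⟩ => m + 1
  | ⟨m, _, .left⟩ => m + 1
  | ⟨m, _, .up⟩ => m + 2
  | ⟨m, _, .down⟩ => m

/-- The position of the cell of a dart in its level. -/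
noncomputable def cellPos (p q : ℕ) : Dart → ℤ
  | ⟨_, i, .right⟩ => i
  | ⟨_, i, .left⟩ => i - 1
  | ⟨m, i, .up⟩ => cellAbove p q m i
  | ⟨m, i, .down⟩ => cellBelow p q m i

/-- Translation by `t` full periods. -/
def shift (p q : ℕ) (t : ℤ) : Dart → Dart
  | ⟨m, i, s⟩ => ⟨m, i + t * period p q m, s⟩

variable {p q : ℕ}

/-- A corner, that is, a vertex on a face, is bounded by exactly two edges. In coordinates the
Galois relation identifies the edge reached and shows that the way back takes the matching branch.
-/
lemma corner_corner (hyp : IsHyperbolic p q) (x : Dart) : corner p q (corner p q x) = x := by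
  have gc := hyp.below_lt_iff
  have mB := fun m => (hyp.levelRegular m).mono_below
  obtain ⟨m, i, _ | _ | _ | _⟩ := x
  · by_cases h : cellBelow p q m i < cellBelow p q m (i + 1)
    · rcases m with _ | m
      · exact absurd h (lt_irrefl _)
      have h1 := (gc m i (cellBelow p q (m + 1) i + 1)).1 (by omega)
      have h2 := (gc m i (cellBelow p q (m + 1) i)).not.1 (by omega)
      have h3 := (gc m (i + 1) (cellBelow p q (m + 1) i + 1)).not.1 (by omega)
      simp only [corner, if_pos h, Nat.add_sub_cancel, add_sub_cancel_right]
      rw [if_pos (by omega)]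
      congr 1; omega
    · have h1 := mB m (show i ≤ i + 1 by omega)
      simp only [corner, if_neg h, add_sub_cancel_right]
  · by_cases h : cellAbove p q m i < cellAbove p q m (i + 1)
    · have h1 := (gc m (cellAbove p q m i + 1) (i + 1)).2 (by omega)
      have h2 := (gc m (cellAbove p q m i + 1) i).not.2 (by omega)
      have h3 := (gc m (cellAbove p q m i) i).2 (by omega)
      simp only [corner, if_pos h, Nat.add_sub_cancel, add_sub_cancel_right]
      rw [if_pos (by omega)]
      congr 1; omega
    · simp only [corner, if_neg h, add_sub_cancel_right]
  · by_cases h : cellAbove p q m (i - 1) < cellAbove p q m i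
    · have h1 := (gc m (cellAbove p q m i) i).2 (by omega)
      have h2 := (gc m (cellAbove p q m i) (i - 1)).not.2 (by omega)
      have h3 := (gc m (cellAbove p q m i + 1) i).not.2 (by omega)
      simp only [corner, if_pos h, Nat.add_sub_cancel]
      rw [if_pos (by omega)]
      congr 1; omega
    · simp only [corner, if_neg h, sub_add_cancel]
  · by_cases h : cellBelow p q m (i - 1) < cellBelow p q m i
    · rcases m with _ | m
      · exact absurd h (lt_irrefl _)
      have h1 := (gc m i (cellBelow p q (m + 1) i + 1)).1 (by omega)
      have h2 := (gc m i (cellBelow p q (m + 1) i)).not.1 (by omega)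
      have h3 := (gc m (i - 1) (cellBelow p q (m + 1) i)).1 (by omega)
      simp only [corner, if_pos h, Nat.add_sub_cancel]
      rw [if_pos (by omega)]
      congr 1; omega
    · simp only [corner, if_neg h, sub_add_cancel]

/-- Rotation of the darts about their cells. -/
noncomputable def rot (hyp : IsHyperbolic p q) : Equiv.Perm Dart :=
  turn.trans (Function.Involutive.toPerm (corner p q) (corner_corner hyp))

variable (hyp : IsHyperbolic p q)

lemma rot_apply (x : Dart) : rot hyp x = corner p q (turn x) := rfl

lemma rot_turn_symm (x : Dart) : rot hyp (turn.symm x) = corner p q x := by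
  rw [rot_apply, Equiv.apply_symm_apply]

lemma turn_turn_turn_turn (x : Dart) : turn (turn (turn (turn x))) = x := by
  obtain ⟨m, i, _ | _ | _ | _⟩ := x <;> rfl

/-- The involutivity of `corner` in terms of the rotations; it is the source of the relation `(a b)
^ 2 = 1`. -/
lemma rot_turn_symm_rot (x : Dart) : rot hyp (turn.symm (rot hyp x)) = turn x := by
  rw [rot_turn_symm, rot_apply, corner_corner hyp]

/-- The quadrant marked by `x` lies between the cells of `x` and of `turn.symm x`. Crossing to the
other edge exchanges their roles, which is why `corner` after `turn` fixes the cell. -/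
lemma cell_corner (hyp : IsHyperbolic p q) (x : Dart) :
    cellLevel (corner p q x) = cellLevel (turn.symm x) ∧
    cellPos p q (corner p q x) = cellPos p q (turn.symm x) := by
  have gc := hyp.below_lt_iff
  have mA := fun m => (hyp.levelRegular m).mono_above
  have mB := fun m => (hyp.levelRegular m).mono_below
  obtain ⟨m, i, _ | _ | _ | _⟩ := x
  · change _ = cellLevel ⟨m, i, .down⟩ ∧ _ = cellPos p q ⟨m, i, .down⟩
    by_cases h : cellBelow p q m i < cellBelow p q m (i + 1)
    · rcases m with _ | m
      · exact absurd h (lt_irrefl _)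
      simp [corner, if_pos h, cellLevel, cellPos]
    · have h1 := mB m (show i ≤ i + 1 by omega)
      simp only [corner, if_neg h, cellLevel, cellPos, true_and]
      omega
  · change _ = cellLevel ⟨m, i, .right⟩ ∧ _ = cellPos p q ⟨m, i, .right⟩
    by_cases h : cellAbove p q m i < cellAbove p q m (i + 1)
    · have h1 := (gc m (cellAbove p q m i + 1) (i + 1)).2 (by omega)
      have h2 := (gc m (cellAbove p q m i + 1) i).not.2 (by omega)
      simp only [corner, if_pos h, cellLevel, cellPos, true_and]
      omega
    · simp [corner, if_neg h, cellLevel, cellPos]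
  · change _ = cellLevel ⟨m, i, .up⟩ ∧ _ = cellPos p q ⟨m, i, .up⟩
    by_cases h : cellAbove p q m (i - 1) < cellAbove p q m i
    · simp [corner, if_pos h, cellLevel, cellPos]
    · have h1 := mA m (show i - 1 ≤ i by omega)
      simp only [corner, if_neg h, cellLevel, cellPos, true_and]
      omega
  · change _ = cellLevel ⟨m, i, .left⟩ ∧ _ = cellPos p q ⟨m, i, .left⟩
    by_cases h : cellBelow p q m (i - 1) < cellBelow p q m i
    · rcases m with _ | m
      · exact absurd h (lt_irrefl _)
      have h1 := (gc m i (cellBelow p q (m + 1) i)).not.1 (by omega)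
      have h3 := (gc m (i - 1) (cellBelow p q (m + 1) i)).1 (by omega)
      simp only [corner, if_pos h, cellLevel, cellPos, Nat.add_sub_cancel, true_and]
      omega
    · simp [corner, if_neg h, cellLevel, cellPos]

lemma cellLevel_rot (x : Dart) : cellLevel (rot hyp x) = cellLevel x := by
  rw [rot_apply, (cell_corner hyp _).1, Equiv.symm_apply_apply]

lemma cellPos_rot (x : Dart) : cellPos p q (rot hyp x) = cellPos p q x := by
  rw [rot_apply, (cell_corner hyp _).2, Equiv.symm_apply_apply]

lemma cellLevel_rot_zpow (k : ℤ) (x : Dart) : cellLevel ((rot hyp ^ k) x) = cellLevel x := by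
  induction k using Int.induction_on with
  | zero => rfl
  | succ k ih => rw [add_comm, zpow_add, zpow_one, Equiv.Perm.mul_apply, cellLevel_rot, ih]
  | pred k ih =>
    rw [← ih, ← cellLevel_rot hyp, ← Equiv.Perm.mul_apply, ← zpow_one_add, add_sub_cancel]

lemma cellLevel_rot_pow (k : ℕ) (x : Dart) : cellLevel ((rot hyp ^ k) x) = cellLevel x := by
  rw [← zpow_natCast, cellLevel_rot_zpow]

lemma cellPos_rot_zpow (k : ℤ) (x : Dart) : cellPos p q ((rot hyp ^ k) x) = cellPos p q x := by
  induction k using Int.induction_on with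
  | zero => rfl
  | succ k ih => rw [add_comm, zpow_add, zpow_one, Equiv.Perm.mul_apply, cellPos_rot, ih]
  | pred k ih =>
    rw [← ih, ← cellPos_rot hyp, ← Equiv.Perm.mul_apply, ← zpow_one_add, add_sub_cancel]

lemma cellLevel_turn (x : Dart) :
    cellLevel (turn x) = cellLevel x + 1 ∨ cellLevel (turn x) + 1 = cellLevel x := by
  obtain ⟨m, i, _ | _ | _ | _⟩ := x <;> simp [turn, cellLevel]

lemma odd_cellLevel_turn (x : Dart) : Odd (cellLevel (turn x)) ↔ ¬ Odd (cellLevel x) := by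
  rcases cellLevel_turn x with h | h
  · rw [h, Nat.odd_add_one]
  · rw [← h, Nat.odd_add_one, not_not]

/-! ### The darts of a cell -/

lemma rot_right_of_lt {m : ℕ} {i : ℤ} (h : cellAbove p q m i < cellAbove p q m (i + 1)) :
    rot hyp ⟨m, i, .right⟩ = ⟨m + 1, cellAbove p q m i + 1, .down⟩ := by
  rw [rot_apply]; exact if_pos h

lemma rot_right_of_not_lt {m : ℕ} {i : ℤ}
    (h : ¬ cellAbove p q m i < cellAbove p q m (i + 1)) :
    rot hyp ⟨m, i, .right⟩ = ⟨m, i + 1, .left⟩ := by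
  rw [rot_apply]; exact if_neg h

lemma rot_down_of_lt {m : ℕ} {k : ℤ}
    (h : cellBelow p q (m + 1) k < cellBelow p q (m + 1) (k + 1)) :
    rot hyp ⟨m + 1, k, .down⟩ = ⟨m, cellBelow p q (m + 1) k + 1, .left⟩ := by
  rw [rot_apply]; exact if_pos h

lemma rot_down_of_not_lt {m : ℕ} {k : ℤ}
    (h : ¬ cellBelow p q m k < cellBelow p q m (k + 1)) :
    rot hyp ⟨m, k, .down⟩ = ⟨m, k + 1, .down⟩ := by
  rw [rot_apply]; exact if_neg h

lemma rot_left_of_lt {m : ℕ} {i : ℤ} (h : cellBelow p q m (i - 1) < cellBelow p q m i) :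
    rot hyp ⟨m, i, .left⟩ = ⟨m - 1, cellBelow p q m i, .up⟩ := by
  rw [rot_apply]; exact if_pos h

lemma rot_left_of_not_lt {m : ℕ} {i : ℤ} (h : ¬ cellBelow p q m (i - 1) < cellBelow p q m i) :
    rot hyp ⟨m, i, .left⟩ = ⟨m, i - 1, .right⟩ := by
  rw [rot_apply]; exact if_neg h

lemma rot_up_of_lt {m : ℕ} {i : ℤ} (h : cellAbove p q m (i - 1) < cellAbove p q m i) :
    rot hyp ⟨m, i, .up⟩ = ⟨m + 1, cellAbove p q m i, .right⟩ := by
  rw [rot_apply]; exact if_pos h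

lemma rot_up_of_not_lt {m : ℕ} {i : ℤ} (h : ¬ cellAbove p q m (i - 1) < cellAbove p q m i) :
    rot hyp ⟨m, i, .up⟩ = ⟨m, i - 1, .up⟩ := by
  rw [rot_apply]; exact if_neg h

/-- Along the top of a cell. -/
lemma rot_pow_right {m : ℕ} {i : ℤ} (k : ℕ)
    (hk : cellAbove p q m i + (k + 1) ≤ cellAbove p q m (i + 1)) :
    (rot hyp ^ (k + 1)) ⟨m, i, .right⟩ = ⟨m + 1, cellAbove p q m i + (k + 1), .down⟩ := by
  induction k with
  | zero =>
    rw [zero_add, pow_one, rot_right_of_lt hyp (by push_cast at hk; omega)]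
    simp
  | succ k ih =>
    push_cast at hk
    rw [pow_succ', Equiv.Perm.mul_apply, ih (by omega)]
    have h1 := (hyp.below_lt_iff m (cellAbove p q m i + (k + 1) + 1) (i + 1)).2 (by omega)
    have h2 := (hyp.below_lt_iff m (cellAbove p q m i + (k + 1)) i).not.2 (by omega)
    rw [rot_down_of_not_lt hyp (by omega)]
    push_cast
    congr 1; ring

lemma rot_pow_right_eq_left {m : ℕ} {i : ℤ} (k : ℕ)
    (hk : cellAbove p q m i + k = cellAbove p q m (i + 1)) :
    (rot hyp ^ (k + 1)) ⟨m, i, .right⟩ = ⟨m, i + 1, .left⟩ := by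
  rcases k with _ | k
  · rw [zero_add, pow_one, rot_right_of_not_lt hyp (by push_cast at hk; omega)]
  · push_cast at hk
    rw [pow_succ', Equiv.Perm.mul_apply, rot_pow_right hyp k (by omega)]
    have h1 := (hyp.below_lt_iff m (cellAbove p q m i + (k + 1)) (i + 1)).2 (by omega)
    have h2 := (hyp.below_lt_iff m (cellAbove p q m i + (k + 1)) i).not.2 (by omega)
    have h3 := (hyp.below_lt_iff m (cellAbove p q m i + (k + 1) + 1) (i + 1)).not.2 (by omega)
    rw [rot_down_of_lt hyp (by omega)]
    congr 1; omega

/-- Along the bottom of a cell. -/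
lemma rot_pow_left {m : ℕ} {i : ℤ} (k : ℕ)
    (hk : cellBelow p q m i + (k + 1) ≤ cellBelow p q m (i + 1)) :
    (rot hyp ^ (k + 1)) ⟨m, i + 1, .left⟩ = ⟨m - 1, cellBelow p q m (i + 1) - k, .up⟩ := by
  induction k with
  | zero =>
    rw [zero_add, pow_one, rot_left_of_lt hyp (by push_cast at hk; rw [add_sub_cancel_right]; omega)]
    simp
  | succ k ih =>
    push_cast at hk
    rcases m with _ | m
    · simp only [cellBelow] at hk; omega
    rw [pow_succ', Equiv.Perm.mul_apply, ih (by omega), Nat.add_sub_cancel]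
    have h1 := (hyp.below_lt_iff m i (cellBelow p q (m + 1) (i + 1) - k - 1)).1 (by omega)
    have h2 := (hyp.below_lt_iff m (i + 1) (cellBelow p q (m + 1) (i + 1) - k)).not.1 (by omega)
    rw [rot_up_of_not_lt hyp (by omega)]
    push_cast
    congr 1; ring

lemma rot_pow_left_eq_right {m : ℕ} {i : ℤ} (k : ℕ)
    (hk : cellBelow p q m i + k = cellBelow p q m (i + 1)) :
    (rot hyp ^ (k + 1)) ⟨m, i + 1, .left⟩ = ⟨m, i, .right⟩ := by
  rcases k with _ | k
  · rw [zero_add, pow_one, rot_left_of_not_lt hyp (by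
      push_cast at hk; rw [add_sub_cancel_right]; omega), add_sub_cancel_right]
  · push_cast at hk
    rcases m with _ | m
    · simp only [cellBelow] at hk; omega
    rw [pow_succ', Equiv.Perm.mul_apply, rot_pow_left hyp k (by omega), Nat.add_sub_cancel]
    have h1 := (hyp.below_lt_iff m i (cellBelow p q (m + 1) (i + 1) - k)).1 (by omega)
    have h2 := (hyp.below_lt_iff m i (cellBelow p q (m + 1) (i + 1) - k - 1)).not.1 (by omega)
    have h3 := (hyp.below_lt_iff m (i + 1) (cellBelow p q (m + 1) (i + 1) - k)).not.1 (by omega)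
    rw [rot_up_of_lt hyp (by omega)]
    congr 1; omega

lemma exists_eq_above_add (hyp : IsHyperbolic p q) (m : ℕ) (i : ℤ) :
    ∃ k : ℕ, cellAbove p q m i + k = cellAbove p q m (i + 1) :=
  ⟨(cellAbove p q m (i + 1) - cellAbove p q m i).toNat, by
    have := (hyp.levelRegular m).mono_above (show i ≤ i + 1 by omega); omega⟩

lemma exists_eq_below_add (hyp : IsHyperbolic p q) (m : ℕ) (i : ℤ) :
    ∃ k : ℕ, cellBelow p q m i + k = cellBelow p q m (i + 1) :=
  ⟨(cellBelow p q m (i + 1) - cellBelow p q m i).toNat, by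
    have := (hyp.levelRegular m).mono_below (show i ≤ i + 1 by omega); omega⟩

lemma above_below_count {m : ℕ} {i : ℤ} {k l : ℕ}
    (hk : cellAbove p q m i + k = cellAbove p q m (i + 1))
    (hl : cellBelow p q m i + l = cellBelow p q m (i + 1)) : (k + l : ℤ) = excess p q m := by
  unfold cellAbove at hk
  linarith

/-- Every dart of a cell is obtained by rotating the dart of the left edge of the cell. -/
lemma exists_rot_pow_eq {x : Dart} {m : ℕ} (hx : cellLevel x = m + 1) :
    ∃ k : ℕ, (rot hyp ^ k) ⟨m, cellPos p q x, .right⟩ = x := by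
  obtain ⟨n, i, _ | _ | _ | _⟩ := x
  · obtain rfl : n = m := by simpa [cellLevel] using hx
    exact ⟨0, rfl⟩
  · obtain rfl : n + 1 = m := by simpa [cellLevel] using hx
    simp only [cellPos]
    set c := cellAbove p q n i with hc
    have h1 := (hyp.below_lt_iff n c i).2 le_rfl
    have h2 := (hyp.below_lt_iff n (c + 1) i).not.2 (by omega)
    obtain ⟨k, hk⟩ := exists_eq_above_add hyp (n + 1) c
    obtain ⟨l, hl⟩ : ∃ l : ℕ, cellBelow p q (n + 1) (c + 1) - l = i :=
      ⟨(cellBelow p q (n + 1) (c + 1) - i).toNat, by omega⟩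
    -- `k + 1` rotations pass over the top to the right edge, then `l + 1` rotations go back along
    -- the bottom to edge `i`.
    refine ⟨(l + 1) + (k + 1), ?_⟩
    rw [pow_add, Equiv.Perm.mul_apply, rot_pow_right_eq_left hyp k hk,
      rot_pow_left hyp l (by omega), hl, Nat.add_sub_cancel]
  · obtain rfl : n = m := by simpa [cellLevel] using hx
    simp only [cellPos]
    obtain ⟨k, hk⟩ := exists_eq_above_add hyp n (i - 1)
    refine ⟨k + 1, ?_⟩
    rw [rot_pow_right_eq_left hyp k hk, sub_add_cancel]
  · obtain rfl : n = m + 1 := by simpa [cellLevel] using hx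
    simp only [cellPos]
    have h1 := hyp.le_above_below m i
    have h2 := hyp.above_below_lt m i
    obtain ⟨l, hl⟩ : ∃ l : ℕ, cellAbove p q m (cellBelow p q (m + 1) i) + (l + 1) = i :=
      ⟨(i - cellAbove p q m (cellBelow p q (m + 1) i) - 1).toNat, by omega⟩
    exact ⟨l + 1, by rw [rot_pow_right hyp l (by omega), hl]⟩

/-- The number of edges of a cell. -/
lemma rot_pow_degree {x : Dart} {m : ℕ} (hx : cellLevel x = m + 1) {d : ℕ}
    (hd : (d : ℤ) = excess p q m + 2) : (rot hyp ^ d) x = x := by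
  obtain ⟨n, hn⟩ := exists_rot_pow_eq hyp hx
  obtain ⟨k, hk⟩ := exists_eq_above_add hyp m (cellPos p q x)
  obtain ⟨l, hl⟩ := exists_eq_below_add hyp m (cellPos p q x)
  have hkl := above_below_count hk hl
  obtain rfl : d = (l + 1) + (k + 1) := by omega
  conv_lhs => rw [← hn]
  rw [← Equiv.Perm.mul_apply, ← pow_add, add_comm, pow_add, Equiv.Perm.mul_apply, pow_add,
    Equiv.Perm.mul_apply, rot_pow_right_eq_left hyp k hk, rot_pow_left_eq_right hyp l hl, hn]

/-- The fundamental face is cut open into a line: its rotation never closes up, except modulo full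
periods. -/
lemma rot_zero_down (i : ℤ) : rot hyp ⟨0, i, .down⟩ = ⟨0, i + 1, .down⟩ :=
  rot_down_of_not_lt hyp (lt_irrefl _)

lemma rot_pow_zero_down (k : ℕ) (i : ℤ) : (rot hyp ^ k) ⟨0, i, .down⟩ = ⟨0, i + k, .down⟩ := by
  induction k with
  | zero => simp
  | succ k ih =>
    rw [pow_succ', Equiv.Perm.mul_apply, ih, rot_zero_down]
    push_cast
    congr 1; ring

/-- A property that is invariant under quarter turns and rotations holds for all darts as soon as it
holds for one dart of the fundamental face. -/
lemma induction_turn_rot {P : Dart → Prop} (base : P ⟨0, 0, .down⟩)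
    (h_turn : ∀ x, P (turn x) ↔ P x) (h_rot : ∀ x, P (rot hyp x) ↔ P x) (x : Dart) : P x := by
  have h_pow : ∀ (k : ℕ) x, P ((rot hyp ^ k) x) ↔ P x := by
    intro k
    induction k with
    | zero => intro x; rfl
    | succ k ih => intro x; rw [pow_succ', Equiv.Perm.mul_apply, h_rot, ih]
  have edge : ∀ m i, P ⟨m, i, .down⟩ → ∀ s, P ⟨m, i, s⟩ := by
    intro m i h s
    have h1 : P ⟨m, i, .right⟩ := (h_turn _).2 h
    have h2 : P ⟨m, i, .up⟩ := (h_turn _).2 h1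
    have h3 : P ⟨m, i, .left⟩ := (h_turn _).2 h2
    cases s <;> assumption
  have down : ∀ m i, P ⟨m, i, .down⟩ := by
    intro m
    induction m with
    | zero =>
      intro i
      induction i using Int.induction_on with
      | zero => exact base
      | succ i ih => rw [← rot_zero_down hyp]; exact (h_rot _).2 ih
      | pred i ih =>
        rw [← h_rot, rot_zero_down, sub_add_cancel]; exact ih
    | succ m ih =>
      intro i
      obtain ⟨k, hk⟩ := exists_rot_pow_eq hyp (x := ⟨m + 1, i, .down⟩) (m := m) rfl
      rw [← hk, h_pow]
      exact edge _ _ (ih _) _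
  exact edge _ _ (down _ _) _

/-! ### Translations -/

lemma turn_shift (t : ℤ) (x : Dart) : turn (shift p q t x) = shift p q t (turn x) := by
  obtain ⟨m, i, _ | _ | _ | _⟩ := x <;> rfl

lemma cellLevel_shift (t : ℤ) (x : Dart) : cellLevel (shift p q t x) = cellLevel x := by
  obtain ⟨m, i, _ | _ | _ | _⟩ := x <;> rfl

lemma below_add_mul_period (hyp : IsHyperbolic p q) (m : ℕ) (t i : ℤ) :
    cellBelow p q (m + 1) (i + t * period p q (m + 1)) =
      cellBelow p q (m + 1) i + t * period p q m := by
  have h1 := (hyp.levelRegular (m + 1)).above_add_mul_period t i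
  unfold cellAbove at h1
  rw [period] at h1
  linarith

lemma cellPos_shift (hyp : IsHyperbolic p q) {x : Dart} {m : ℕ} (hx : cellLevel x = m + 1) (t : ℤ) :
    cellPos p q (shift p q t x) = cellPos p q x + t * period p q m := by
  obtain ⟨n, i, _ | _ | _ | _⟩ := x
  · obtain rfl : n = m := by simpa [cellLevel] using hx
    rfl
  · obtain rfl : n + 1 = m := by simpa [cellLevel] using hx
    exact (hyp.levelRegular n).above_add_mul_period t i
  · obtain rfl : n = m := by simpa [cellLevel] using hx
    simp only [cellPos, shift]; ring
  · obtain rfl : n = m + 1 := by simpa [cellLevel] using hx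
    exact below_add_mul_period hyp m t i

lemma corner_shift (hyp : IsHyperbolic p q) (t : ℤ) (x : Dart) :
    corner p q (shift p q t x) = shift p q t (corner p q x) := by
  have hA := fun m i => (hyp.levelRegular m).above_add_mul_period t i
  have hB := fun m i => below_add_mul_period hyp m t i
  obtain ⟨m, i, s⟩ := x
  have e1 : i + t * period p q m + 1 = (i + 1) + t * period p q m := by ring
  have e2 : i + t * period p q m - 1 = (i - 1) + t * period p q m := by ring
  cases s
  · rcases m with _ | m
    · simp [corner, shift, cellBelow, e1]
    simp only [corner, shift, e1, hB, add_lt_add_iff_right, Nat.add_sub_cancel]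
    split_ifs
    · simp only; congr 1; ring
    · rfl
  · simp only [corner, shift, e1, hA, add_lt_add_iff_right]
    split_ifs
    · simp only; congr 1; ring
    · rfl
  · simp only [corner, shift, e2, hA, add_lt_add_iff_right]
    split_ifs <;> rfl
  · rcases m with _ | m
    · simp [corner, shift, cellBelow, e2]
    simp only [corner, shift, e2, hB, add_lt_add_iff_right, Nat.add_sub_cancel]
    split_ifs <;> rfl

lemma rot_shift (t : ℤ) (x : Dart) : rot hyp (shift p q t x) = shift p q t (rot hyp x) := by
  rw [rot_apply, rot_apply, turn_shift, corner_shift hyp]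

lemma shift_zero (x : Dart) : shift p q 0 x = x := by
  obtain ⟨m, i, s⟩ := x; simp [shift]

lemma shift_shift (s t : ℤ) (x : Dart) : shift p q s (shift p q t x) = shift p q (t + s) x := by
  obtain ⟨m, i, s⟩ := x; simp only [shift]; congr 1; ring

end Dart
-- Labelling the darts by group elements
namespace Dart

/-- The generator fixing a cell of the given level, raised by one: odd levels are the vertices. -/
def cellGen {G : Type*} (a b : G) (l : ℕ) : G := if Odd l then b else a

/-- The group element of the dart of an edge at the cell on the given side, in terms of that at the
cell below. -/
def sideElt {G : Type*} [Group G] (a b : G) (m : ℕ) (g : G) : Side → G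
  | .right => if Even m then g * (a * b) else g
  | .up => g * (a * b)
  | .left => if Even m then g else g * (a * b)
  | .down => g

/-- The group element of the dart of an edge at the cell below it. -/
noncomputable def downElt {G : Type*} [Group G] (p q : ℕ) (a b : G) : ℕ → ℤ → G
  | 0 => fun i => a ^ i
  | m + 1 => fun k =>
    sideElt a b m (downElt p q a b m (cellBelow p q (m + 1) k)) .right *
      cellGen a b (m + 1) ^ (k - cellAbove p q m (cellBelow p q (m + 1) k))

/-- The group element that carries the base dart to a given dart. For a dart at a face it is that of
the dart of the same edge at the vertex preceding it in the order of the quarter turns. -/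
noncomputable def elt {G : Type*} [Group G] (p q : ℕ) (a b : G) (x : Dart) : G :=
  sideElt a b x.level (downElt p q a b x.level x.pos) x.side

variable {G : Type*} [Group G] {p q : ℕ} {a b : G}

lemma elt_turn (hab : (a * b) ^ 2 = 1) (x : Dart) :
    elt p q a b (turn x) =
      if Odd (cellLevel x) then elt p q a b x else elt p q a b x * (a * b) := by
  have hab' : ∀ g : G, g * (a * b) * (a * b) = g := fun g => by
    rw [mul_assoc, ← sq, hab, mul_one]
  have h_odd : ∀ m : ℕ, Odd m ↔ ¬ Even m := fun m => Nat.not_even_iff_odd.symm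
  obtain ⟨m, i, _ | _ | _ | _⟩ := x <;> by_cases hm : Even m <;>
    simp only [turn, elt, sideElt, cellLevel, h_odd, hm, hab', Nat.even_add_one,
      if_true, if_false, Equiv.coe_fn_mk, not_true, not_false_eq_true]

lemma elt_down_succ (m : ℕ) (k : ℤ) :
    elt p q a b ⟨m + 1, k, .down⟩ = elt p q a b ⟨m, cellBelow p q (m + 1) k, .right⟩ *
      cellGen a b (m + 1) ^ (k - cellAbove p q m (cellBelow p q (m + 1) k)) := rfl

/-- The group elements are compatible with the rotation of the dart `x`. -/
def RotCompat (hyp : IsHyperbolic p q) (a b : G) (x : Dart) : Prop :=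
  elt p q a b (rot hyp x) = elt p q a b x * cellGen a b (cellLevel x)

variable {hyp : IsHyperbolic p q}

lemma RotCompat.pow {x : Dart} {n : ℕ} (h : ∀ k < n, RotCompat hyp a b ((rot hyp ^ k) x)) :
    elt p q a b ((rot hyp ^ n) x) = elt p q a b x * cellGen a b (cellLevel x) ^ n := by
  induction n with
  | zero => simp
  | succ n ih =>
    have h1 := h n (Nat.lt_succ_self n)
    have h2 : cellLevel ((rot hyp ^ n) x) = cellLevel x := cellLevel_rot_pow hyp n x
    rw [RotCompat, h2, ih fun k hk => h k (by omega)] at h1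
    rw [pow_succ', Equiv.Perm.mul_apply, h1, pow_succ, mul_assoc]

/-- Compatibility of the rotations at a corner about the vertex and about the face. -/
lemma RotCompat.of_turn_symm_rot (hab : (a * b) ^ 2 = 1) {x : Dart}
    (h : RotCompat hyp a b (turn.symm (rot hyp x))) : RotCompat hyp a b x := by
  obtain ⟨y, hy⟩ : ∃ y, turn y = rot hyp x := ⟨_, Equiv.apply_symm_apply _ _⟩
  have hl : ¬ Odd (cellLevel y) ↔ Odd (cellLevel x) := by
    rw [← odd_cellLevel_turn, hy, cellLevel_rot]
  unfold RotCompat at h ⊢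
  -- Since `rot ∘ turn.symm ∘ rot = turn`, both compatibilities compare the same labels, those of
  -- `x` and of `rot x` up to quarter turns.
  rw [rot_turn_symm_rot, elt_turn hab, ← hy, Equiv.symm_apply_apply] at h
  rw [← hy, elt_turn hab]
  by_cases hx : Odd (cellLevel x)
  · have hy' := hl.2 hx
    simp only [cellGen, hx, hy', if_true, if_false] at h ⊢
    rw [h]; group
  · have hy' : Odd (cellLevel y) := by by_contra hc; exact hx (hl.1 hc)
    simp only [cellGen, hx, hy', if_true, if_false] at h ⊢
    rw [← mul_left_inj b, ← h]; group

lemma rotCompat_right_of_lt {m : ℕ} {i : ℤ}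
    (h : cellAbove p q m i < cellAbove p q m (i + 1)) :
    RotCompat hyp a b ⟨m, i, .right⟩ := by
  have h1 := (hyp.below_lt_iff m (cellAbove p q m i + 1) (i + 1)).2 (by omega)
  have h2 := (hyp.below_lt_iff m (cellAbove p q m i + 1) i).not.2 (by omega)
  rw [RotCompat, rot_right_of_lt hyp h, elt_down_succ,
    show cellBelow p q (m + 1) (cellAbove p q m i + 1) = i by omega, add_sub_cancel_left, zpow_one]
  rfl

lemma rotCompat_down_of_not_lt {m : ℕ} {k : ℤ}
    (h : ¬ cellBelow p q (m + 1) k < cellBelow p q (m + 1) (k + 1)) :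
    RotCompat hyp a b ⟨m + 1, k, .down⟩ := by
  have h1 := (hyp.levelRegular (m + 1)).mono_below (show k ≤ k + 1 by omega)
  rw [RotCompat, rot_down_of_not_lt hyp h, elt_down_succ, elt_down_succ,
    show cellBelow p q (m + 1) (k + 1) = cellBelow p q (m + 1) k by omega, mul_assoc]
  congr 1
  change _ = _ * cellGen a b (m + 1)
  rw [← zpow_add_one]
  congr 1; ring

/-- Rotating from the right edge or a bottom edge of a cell crosses a corner shared with a cell one
level lower. This allows compatibility there to be imported by induction. -/
lemma cellLevel_turn_symm_rot {x : Dart} {m : ℕ} (hx : cellLevel x = m + 1)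
    (hs : x.side = .left ∨ x.side = .up) : cellLevel (turn.symm (rot hyp x)) = m := by
  have h2 : (rot hyp x).side = .right ∨ (rot hyp x).side = .up := by
    obtain ⟨n, i, _ | _ | _ | _⟩ := x
    · simp at hs
    · by_cases h : cellAbove p q n (i - 1) < cellAbove p q n i
      · rw [rot_up_of_lt hyp h]; simp
      · rw [rot_up_of_not_lt hyp h]; simp
    · by_cases h : cellBelow p q n (i - 1) < cellBelow p q n i
      · rw [rot_left_of_lt hyp h]; simp
      · rw [rot_left_of_not_lt hyp h]; simp
    · simp at hs
  have h3 := cellLevel_rot hyp x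
  rw [hx] at h3
  generalize rot hyp x = y at h2 h3
  obtain ⟨n, i, _ | _ | _ | _⟩ := y
  · change n = m; simpa [cellLevel] using h3
  · change n + 1 = m; simpa [cellLevel] using h3
  · simp at h2
  · simp at h2

lemma cellGen_pow (ha : a ^ p = 1) (hb : b ^ q = 1) {m d : ℕ}
    (hd : (d : ℤ) = excess p q m + 2) : cellGen a b (m + 1) ^ d = 1 := by
  unfold cellGen excess at *
  simp only [Nat.odd_add_one, Nat.not_odd_iff_even]
  split_ifs at hd ⊢
  · rwa [show d = q by omega]
  · rwa [show d = p by omega]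

/-- Induction on the level of the cell. Along the top the labels are compatible by construction,
along the bottom by the corner relation with the level below. One rotation of the cycle remains,
from the last top edge to the right edge, and the relation `a ^ p = 1` or `b ^ q = 1` forces it. -/
theorem rotCompat (hyp : IsHyperbolic p q) (ha : a ^ p = 1) (hb : b ^ q = 1)
    (hab : (a * b) ^ 2 = 1) (x : Dart) : RotCompat hyp a b x := by
  suffices ∀ l x, cellLevel x = l → RotCompat hyp a b x from this _ x rfl
  intro l
  induction l with
  | zero =>
    rintro ⟨m, i, _ | _ | _ | _⟩ hx
    · simp [cellLevel] at hx
    · simp [cellLevel] at hx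
    · simp [cellLevel] at hx
    · obtain rfl : m = 0 := hx
      rw [RotCompat, rot_zero_down]
      exact zpow_add_one a i
  | succ m ih =>
    have bottom : ∀ x, cellLevel x = m + 1 → x.side = .left ∨ x.side = .up →
        RotCompat hyp a b x := fun x hx hs =>
      RotCompat.of_turn_symm_rot hab (ih _ (cellLevel_turn_symm_rot hx hs))
    -- Going on from the right edge, `l + 1` bottom rotations return to the left edge; with the `k`
    -- top ones and the closing one these make `k + l + 2` rotations, the degree of the cell.
    have closing : ∀ (i : ℤ) (k : ℕ), cellAbove p q m i + k = cellAbove p q m (i + 1) →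
        RotCompat hyp a b ((rot hyp ^ k) ⟨m, i, .right⟩) := by
      intro i k hk
      obtain ⟨l, hl⟩ := exists_eq_below_add hyp m i
      have hkl := above_below_count hk hl
      have top : elt p q a b ((rot hyp ^ k) ⟨m, i, .right⟩) =
          elt p q a b ⟨m, i, .right⟩ * cellGen a b (m + 1) ^ k := by
        refine RotCompat.pow fun n hn => ?_
        rcases n with _ | n
        · exact rotCompat_right_of_lt (by omega)
        · rw [rot_pow_right hyp n (by omega)]
          have h1 := (hyp.below_lt_iff m (cellAbove p q m i + (n + 1) + 1) (i + 1)).2 (by omega)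
          have h2 := (hyp.below_lt_iff m (cellAbove p q m i + (n + 1)) i).not.2 (by omega)
          exact rotCompat_down_of_not_lt (by omega)
      have bot : elt p q a b ⟨m, i, .right⟩ =
          elt p q a b ⟨m, i + 1, .left⟩ * cellGen a b (m + 1) ^ (l + 1) := by
        rw [← rot_pow_left_eq_right hyp l hl]
        refine RotCompat.pow fun n hn => ?_
        rcases n with _ | n
        · exact bottom _ rfl (Or.inl rfl)
        · refine bottom _ ?_ ?_
          · exact cellLevel_rot_pow hyp _ _
          · rw [rot_pow_left hyp n (by omega)]
            exact Or.inr rfl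
      have hlev : cellLevel ((rot hyp ^ k) ⟨m, i, .right⟩) = m + 1 :=
        cellLevel_rot_pow hyp _ _
      rw [RotCompat, hlev, ← Equiv.Perm.mul_apply, ← pow_succ',
        rot_pow_right_eq_left hyp k hk, top, bot, mul_assoc, mul_assoc, ← pow_succ, ← pow_add,
        cellGen_pow ha hb (by push_cast; omega), mul_one]
    rintro ⟨n, i, _ | _ | _ | _⟩ hx
    · obtain rfl : n = m := by simpa [cellLevel] using hx
      by_cases h : cellAbove p q n i < cellAbove p q n (i + 1)
      · exact rotCompat_right_of_lt h
      · obtain ⟨k, hk⟩ := exists_eq_above_add hyp n i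
        obtain rfl : k = 0 := by omega
        exact closing i 0 hk
    · exact bottom _ hx (Or.inr rfl)
    · exact bottom _ hx (Or.inl rfl)
    · obtain rfl : n = m + 1 := by simpa [cellLevel] using hx
      by_cases h : cellBelow p q (m + 1) i < cellBelow p q (m + 1) (i + 1)
      · have h1 := hyp.le_above_below m i
        have h2 := hyp.above_below_lt m i
        have h3 := (hyp.below_lt_iff m (i + 1)
          (cellBelow p q (m + 1) i + 1)).not.1 (by omega)
        obtain ⟨k, hk⟩ : ∃ k : ℕ,
            cellAbove p q m (cellBelow p q (m + 1) i) + (k + 1) = i :=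
          ⟨(i - cellAbove p q m (cellBelow p q (m + 1) i) - 1).toNat, by omega⟩
        have := closing (cellBelow p q (m + 1) i) (k + 1) (by push_cast; omega)
        rwa [rot_pow_right hyp k (by omega), hk] at this
      · exact rotCompat_down_of_not_lt h

lemma elt_rot (hyp : IsHyperbolic p q) (ha : a ^ p = 1) (hb : b ^ q = 1)
    (hab : (a * b) ^ 2 = 1) (x : Dart) :
    elt p q a b (rot hyp x) = elt p q a b x * cellGen a b (cellLevel x) :=
  rotCompat hyp ha hb hab x

lemma elt_rot_zpow (hyp : IsHyperbolic p q) (ha : a ^ p = 1) (hb : b ^ q = 1)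
    (hab : (a * b) ^ 2 = 1) (k : ℤ) (x : Dart) :
    elt p q a b ((rot hyp ^ k) x) = elt p q a b x * cellGen a b (cellLevel x) ^ k := by
  have key : ∀ k : ℤ, elt p q a b ((rot hyp ^ (k + 1)) x) =
      elt p q a b ((rot hyp ^ k) x) * cellGen a b (cellLevel x) := fun k => by
    rw [zpow_add_one, (Commute.zpow_self (rot hyp) k).eq, Equiv.Perm.mul_apply,
      elt_rot hyp ha hb hab, cellLevel_rot_zpow]
  induction k using Int.induction_on with
  | zero => simp
  | succ k ih => rw [key, ih, zpow_add_one, mul_assoc]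
  | pred k ih =>
    have := key (-(k : ℤ) - 1)
    rw [sub_add_cancel, ih] at this
    rw [zpow_sub_one (cellGen a b (cellLevel x)), ← mul_assoc, this, mul_inv_cancel_right]

/-- On the fundamental face this is `a ^ p = 1`; turns and rotations commute with shifts and carry
it to all darts. -/
lemma elt_shift (hyp : IsHyperbolic p q) (ha : a ^ p = 1) (hb : b ^ q = 1)
    (hab : (a * b) ^ 2 = 1) (t : ℤ) (x : Dart) :
    elt p q a b (shift p q t x) = elt p q a b x := by
  refine induction_turn_rot hyp (P := fun x => elt p q a b (shift p q t x) = elt p q a b x)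
    ?_ ?_ ?_ x
  · change a ^ (0 + t * (p : ℤ)) = a ^ (0 : ℤ)
    rw [zero_add, mul_comm, zpow_mul, zpow_natCast, ha, one_zpow, zpow_zero]
  · intro x
    simp only [← turn_shift, elt_turn hab, cellLevel_shift]
    split_ifs
    · rfl
    · exact mul_left_inj _
  · intro x
    rw [← rot_shift, elt_rot hyp ha hb hab, elt_rot hyp ha hb hab, cellLevel_shift, mul_left_inj]

end Dart

/-! ### The action of the Fuchsian group on darts modulo full periods -/

section
variable (p q : ℕ)

lemma rotFace_pow : rotFace p q ^ p = 1 := by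
  have h : PresentedGroup.mk (relators p q) (FreeGroup.of Gen.a ^ p) = 1 :=
    PresentedGroup.one_of_mem (Or.inl rfl)
  rwa [map_pow] at h

lemma rotVertex_pow : rotVertex p q ^ q = 1 := by
  have h : PresentedGroup.mk (relators p q) (FreeGroup.of Gen.b ^ q) = 1 :=
    PresentedGroup.one_of_mem (Or.inr (Or.inl rfl))
  rwa [map_pow] at h

lemma rotFace_mul_rotVertex_sq : (rotFace p q * rotVertex p q) ^ 2 = 1 := by
  have h : PresentedGroup.mk (relators p q) ((FreeGroup.of Gen.a * FreeGroup.of Gen.b) ^ 2) = 1 :=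
    PresentedGroup.one_of_mem (Or.inr (Or.inr rfl))
  rwa [map_pow, map_mul] at h

end

namespace Dart

/-- Two darts at vertices are equivalent if they differ by a translation by full periods. -/
def shiftSetoid (p q : ℕ) : Setoid {x : Dart // Odd (cellLevel x)} where
  r x y := ∃ t, shift p q t x.1 = y.1
  iseqv :=
    { refl := fun x => ⟨0, shift_zero _⟩
      symm := by
        rintro x y ⟨t, h⟩
        exact ⟨-t, by rw [← h, shift_shift, add_neg_cancel, shift_zero]⟩
      trans := by
        rintro x y z ⟨s, h⟩ ⟨t, h'⟩
        exact ⟨s + t, by rw [← h', ← h, shift_shift]⟩ }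

/-- The darts at vertices, up to translation by full periods. -/
abbrev DartClass (p q : ℕ) : Type := Quotient (shiftSetoid p q)

/-- The class of a dart at a vertex. -/
def toClass (p q : ℕ) (x : Dart) (hx : Odd (cellLevel x)) : DartClass p q :=
  Quotient.mk (shiftSetoid p q) ⟨x, hx⟩

/-- The permutations of the darts that act on the classes of the darts at vertices. -/
def equivariantPerm (p q : ℕ) : Subgroup (Equiv.Perm Dart) where
  carrier := {f | (∀ x, Odd (cellLevel (f x)) ↔ Odd (cellLevel x)) ∧
    ∀ t x, f (shift p q t x) = shift p q t (f x)}
  one_mem' := ⟨fun _ => Iff.rfl, fun _ _ => rfl⟩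
  mul_mem' := by
    rintro f g ⟨hf, hf'⟩ ⟨hg, hg'⟩
    exact ⟨fun x => (hf _).trans (hg x), fun t x => by
      rw [Equiv.Perm.mul_apply, hg', hf', Equiv.Perm.mul_apply]⟩
  inv_mem' := by
    rintro f ⟨hf, hf'⟩
    refine ⟨fun x => ?_, fun t x => f.injective ?_⟩
    · rw [← hf, Equiv.Perm.inv_def, Equiv.apply_symm_apply]
    · rw [hf', Equiv.Perm.inv_def, Equiv.apply_symm_apply, Equiv.apply_symm_apply]

/-- The action of a permutation of the darts on the classes of the darts at vertices. -/
def classPerm (p q : ℕ) : equivariantPerm p q →* Equiv.Perm (DartClass p q) where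
  toFun f := Quotient.congr (f.1.subtypePerm f.2.1) fun x y => by
    constructor
    · rintro ⟨t, h⟩
      exact ⟨t, by simp only [Equiv.Perm.subtypePerm_apply, ← f.2.2, h]⟩
    · rintro ⟨t, h⟩
      simp only [Equiv.Perm.subtypePerm_apply, ← f.2.2] at h
      exact ⟨t, f.1.injective h⟩
  map_one' := by ext x; induction x using Quotient.ind; rfl
  map_mul' f g := by ext x; induction x using Quotient.ind; rfl

variable {p q : ℕ}

lemma toClass_eq_of_eq {x y : Dart} (h : x = y) (hx : Odd (cellLevel x)) (hy : Odd (cellLevel y)) :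
    toClass p q x hx = toClass p q y hy := by
  subst h; rfl

lemma exists_toClass_eq (z : DartClass p q) : ∃ x hx, toClass p q x hx = z := by
  induction z using Quotient.ind with
  | _ x => exact ⟨x.1, x.2, rfl⟩

lemma classPerm_toClass (f : equivariantPerm p q) (x : Dart) (hx : Odd (cellLevel x)) :
    classPerm p q f (toClass p q x hx) = toClass p q (f.1 x) ((f.2.1 x).2 hx) := rfl

variable (hyp : IsHyperbolic p q)

/-- The rotation about the vertex of a dart. -/
noncomputable def vertexRot : equivariantPerm p q :=
  ⟨rot hyp, fun x => by rw [cellLevel_rot], rot_shift hyp⟩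

/-- The rotation about the face following a dart at a vertex. -/
noncomputable def faceRot : equivariantPerm p q :=
  ⟨turn⁻¹ * rot hyp * turn, fun x => by
    have h := odd_cellLevel_turn (turn.symm (rot hyp (turn x)))
    rw [Equiv.apply_symm_apply, cellLevel_rot, odd_cellLevel_turn] at h
    exact (not_iff_not.1 h).symm, fun t x => by
    apply turn.injective
    simp only [Equiv.Perm.mul_apply, turn_shift, Equiv.Perm.inv_def, Equiv.apply_symm_apply, rot_shift]⟩

lemma vertexRot_pow : classPerm p q (vertexRot hyp) ^ q = 1 := by
  rw [← map_pow]
  ext z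
  obtain ⟨x, hx, rfl⟩ := exists_toClass_eq z
  rw [classPerm_toClass]
  refine toClass_eq_of_eq ?_ _ _
  obtain ⟨m, hm⟩ := hx
  refine rot_pow_degree hyp (m := 2 * m) hm ?_
  simp [excess]

lemma faceRot_pow : classPerm p q (faceRot hyp) ^ p = 1 := by
  rw [← map_pow]
  ext z
  obtain ⟨x, hx, rfl⟩ := exists_toClass_eq z
  have key : ((faceRot hyp) ^ p).1 x = turn.symm ((rot hyp ^ p) (turn x)) := by
    change ((turn⁻¹ * rot hyp * turn) ^ p) x = _
    have := conj_pow (i := p) (a := turn⁻¹) (b := rot hyp)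
    rw [inv_inv] at this
    rw [this]
    rfl
  rw [classPerm_toClass]
  rcases h : cellLevel (turn x) with _ | m
  · have hs : shift p q 1 x = ((faceRot hyp) ^ p).1 x := by
      rw [key, Equiv.eq_symm_apply, turn_shift]
      generalize turn x = y at h
      obtain ⟨n, i, _ | _ | _ | _⟩ := y
      · simp [cellLevel] at h
      · simp [cellLevel] at h
      · simp [cellLevel] at h
      · obtain rfl : n = 0 := h
        rw [rot_pow_zero_down]
        simp [shift, period]
    exact (Quotient.sound (s := shiftSetoid p q) ⟨1, hs⟩).symm
  · refine toClass_eq_of_eq ?_ _ _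
    rw [key, rot_pow_degree hyp h, Equiv.symm_apply_apply]
    have h1 : Even (cellLevel (turn x)) := by
      rw [← Nat.not_odd_iff_even, odd_cellLevel_turn]; exact not_not.2 hx
    rw [h, Nat.even_add_one] at h1
    simp [excess, h1]

/-- Rotating about the face and then about the vertex is the half turn about the edge, of order 2.
-/
lemma rot_faceRot (x : Dart) : rot hyp ((faceRot hyp).1 x) = turn (turn x) :=
  rot_turn_symm_rot hyp (turn x)

lemma vertexRot_mul_faceRot_sq :
    (classPerm p q (vertexRot hyp) * classPerm p q (faceRot hyp)) ^ 2 = 1 := by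
  rw [← map_mul, ← map_pow]
  ext z
  obtain ⟨x, hx, rfl⟩ := exists_toClass_eq z
  rw [classPerm_toClass]
  refine toClass_eq_of_eq ?_ _ _
  change rot hyp ((faceRot hyp).1 (rot hyp ((faceRot hyp).1 x))) = x
  rw [rot_faceRot, rot_faceRot, turn_turn_turn_turn]

/-- The action of the Fuchsian group on the classes of darts. -/
noncomputable def action : FuchsianGroup p q →* Equiv.Perm (DartClass p q) :=
  PresentedGroup.toGroup
    (f := fun
      -- Rotations multiply labels on the right, so inverses are needed for a left action.
      | Gen.a => (classPerm p q (faceRot hyp))⁻¹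
      | Gen.b => (classPerm p q (vertexRot hyp))⁻¹) (by
    rintro r (rfl | rfl | rfl)
    · simp [faceRot_pow]
    · simp [vertexRot_pow]
    · rw [map_pow, map_mul, FreeGroup.lift_apply_of, FreeGroup.lift_apply_of, ← mul_inv_rev,
        inv_pow, vertexRot_mul_faceRot_sq, inv_one])

lemma action_rotFace : action hyp (rotFace p q) = (classPerm p q (faceRot hyp))⁻¹ :=
  PresentedGroup.toGroup.of _

lemma action_rotVertex : action hyp (rotVertex p q) = (classPerm p q (vertexRot hyp))⁻¹ :=
  PresentedGroup.toGroup.of _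

/-- The element of the Fuchsian group that carries the base dart to a given dart. -/
noncomputable def groupElt (p q : ℕ) (x : Dart) : FuchsianGroup p q :=
  elt p q (rotFace p q) (rotVertex p q) x

lemma groupElt_turn {x : Dart} (hx : Odd (cellLevel x)) :
    groupElt p q (turn x) = groupElt p q x := by
  rw [groupElt, elt_turn (rotFace_mul_rotVertex_sq p q), if_pos hx, groupElt]

lemma groupElt_rot_zpow_of_odd (k : ℤ) {x : Dart} (hx : Odd (cellLevel x)) :
    groupElt p q ((rot hyp ^ k) x) = groupElt p q x * rotVertex p q ^ k := by
  rw [groupElt, elt_rot_zpow hyp (rotFace_pow p q) (rotVertex_pow p q)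
    (rotFace_mul_rotVertex_sq p q), cellGen, if_pos hx, groupElt]

lemma groupElt_rot_zpow_of_not_odd (k : ℤ) {x : Dart} (hx : ¬ Odd (cellLevel x)) :
    groupElt p q ((rot hyp ^ k) x) = groupElt p q x * rotFace p q ^ k := by
  rw [groupElt, elt_rot_zpow hyp (rotFace_pow p q) (rotVertex_pow p q)
    (rotFace_mul_rotVertex_sq p q), cellGen, if_neg hx, groupElt]

lemma groupElt_turn_symm_rot_zpow_turn (k : ℤ) {x : Dart} (hx : Odd (cellLevel x)) :
    Odd (cellLevel (turn.symm ((rot hyp ^ k) (turn x)))) ∧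
    groupElt p q (turn.symm ((rot hyp ^ k) (turn x))) = groupElt p q x * rotFace p q ^ k := by
  have h1 : ¬ Odd (cellLevel (turn x)) := by rw [odd_cellLevel_turn]; exact not_not.2 hx
  have h2 : Odd (cellLevel (turn.symm ((rot hyp ^ k) (turn x)))) := by
    rw [← not_not (a := Odd _), ← odd_cellLevel_turn, Equiv.apply_symm_apply, cellLevel_rot_zpow]
    exact h1
  refine ⟨h2, ?_⟩
  rw [← groupElt_turn h2, Equiv.apply_symm_apply, groupElt_rot_zpow_of_not_odd hyp k h1,
    groupElt_turn hx]

/-- The group element of a class of darts. -/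
noncomputable def classElt : DartClass p q → FuchsianGroup p q :=
  Quotient.lift (fun x => groupElt p q x.1) (by
    rintro x y ⟨t, h⟩
    simp only [← h, groupElt]
    exact (elt_shift hyp (rotFace_pow p q) (rotVertex_pow p q)
      (rotFace_mul_rotVertex_sq p q) t x.1).symm)

/-- Labels intertwine the action with right multiplication by inverses. The elements for which this
holds form a subgroup, and it contains both generators. -/
lemma classElt_action (g : FuchsianGroup p q) (z : DartClass p q) :
    classElt hyp (action hyp g z) = classElt hyp z * g⁻¹ := by
  let H : Subgroup (FuchsianGroup p q) :=
    { carrier := {g | ∀ z, classElt hyp (action hyp g z) = classElt hyp z * g⁻¹}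
      one_mem' := fun z => by simp
      mul_mem' := fun {g h} hg hh z => by
        rw [map_mul, Equiv.Perm.mul_apply, hg, hh, mul_inv_rev, mul_assoc]
      inv_mem' := fun {g} hg z => by
        have := hg (action hyp g⁻¹ z)
        rw [← Equiv.Perm.mul_apply, ← map_mul, mul_inv_cancel, map_one, Equiv.Perm.one_apply] at this
        rw [this, inv_inv, inv_mul_cancel_right] }
  have of_inv : ∀ (f : equivariantPerm p q) (g : FuchsianGroup p q),
      (∀ x, Odd (cellLevel x) → groupElt p q (f.1 x) = groupElt p q x * g) →
      ∀ z, classElt hyp ((classPerm p q f)⁻¹ z) = classElt hyp z * g⁻¹ := by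
    intro f g h z
    obtain ⟨w, rfl⟩ := (classPerm p q f).surjective z
    rw [Equiv.Perm.inv_def, Equiv.symm_apply_apply]
    obtain ⟨x, hx, rfl⟩ := exists_toClass_eq w
    rw [classPerm_toClass]
    change groupElt p q x = groupElt p q (f.1 x) * g⁻¹
    rw [h x hx, mul_inv_cancel_right]
  have htop : H = ⊤ := by
    rw [eq_top_iff, ← PresentedGroup.closure_range_of, Subgroup.closure_le]
    rintro _ ⟨_ | _, rfl⟩
    · change ∀ z, classElt hyp (action hyp (rotFace p q) z) = _ * (rotFace p q)⁻¹
      rw [action_rotFace]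
      refine of_inv _ _ fun x hx => ?_
      have := (groupElt_turn_symm_rot_zpow_turn hyp 1 hx).2
      rwa [zpow_one, zpow_one] at this
    · change ∀ z, classElt hyp (action hyp (rotVertex p q) z) = _ * (rotVertex p q)⁻¹
      rw [action_rotVertex]
      refine of_inv _ _ fun x hx => ?_
      have := groupElt_rot_zpow_of_odd hyp 1 hx
      rwa [zpow_one, zpow_one] at this
  exact (htop ▸ Subgroup.mem_top g : g ∈ H) z

/-- The base dart. -/
def base : Dart := ⟨0, 0, .left⟩

lemma odd_cellLevel_base : Odd (cellLevel base) := odd_one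

lemma groupElt_base : groupElt p q base = 1 := zpow_zero _

/-- Transitivity: the orbit is stable under both rotations, hence under half turns. Lying in it,
transferred to face darts through the preceding vertex dart, is therefore invariant under `turn` and
`rot`, which connect all darts. -/
lemma exists_action_base (x : Dart) (hx : Odd (cellLevel x)) :
    ∃ g, action hyp g (toClass p q base odd_cellLevel_base) = toClass p q x hx := by
  set O : Set (DartClass p q) :=
    Set.range fun g => action hyp g (toClass p q base odd_cellLevel_base)
  have mem_action : ∀ g z, action hyp g z ∈ O ↔ z ∈ O := by
    intro g z
    constructor
    · rintro ⟨h, hh⟩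
      refine ⟨g⁻¹ * h, ?_⟩
      simp only [map_mul, Equiv.Perm.mul_apply] at hh ⊢
      rw [hh, map_inv, Equiv.Perm.inv_def, Equiv.symm_apply_apply]
    · rintro ⟨h, rfl⟩
      exact ⟨g * h, by simp only [map_mul, Equiv.Perm.mul_apply]⟩
  have mem_v : ∀ z, classPerm p q (vertexRot hyp) z ∈ O ↔ z ∈ O := fun z => by
    rw [← mem_action (rotVertex p q)⁻¹ z, map_inv, action_rotVertex, inv_inv]
  have mem_f : ∀ z, classPerm p q (faceRot hyp) z ∈ O ↔ z ∈ O := fun z => by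
    rw [← mem_action (rotFace p q)⁻¹ z, map_inv, action_rotFace, inv_inv]
  let Q : Dart → Prop := fun x => ∃ h, toClass p q x h ∈ O
  have Q_iff : ∀ {x}, (hx : Odd (cellLevel x)) → (Q x ↔ toClass p q x hx ∈ O) := fun hx =>
    ⟨fun ⟨_, h⟩ => h, fun h => ⟨hx, h⟩⟩
  have Q_rot : ∀ {x}, Odd (cellLevel x) → (Q (rot hyp x) ↔ Q x) := fun {x} hx => by
    rw [Q_iff hx, Q_iff (by rwa [cellLevel_rot]), ← mem_v (toClass p q x hx)]; rfl
  have Q_face : ∀ {x}, Odd (cellLevel x) → (Q ((faceRot hyp).1 x) ↔ Q x) := fun {x} hx => by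
    rw [Q_iff hx, Q_iff (((faceRot hyp).2.1 x).2 hx), ← mem_f (toClass p q x hx)]; rfl
  have odd_turn_symm : ∀ x, Odd (cellLevel (turn.symm x)) ↔ ¬ Odd (cellLevel x) := fun x => by
    have := odd_cellLevel_turn (turn.symm x)
    rw [Equiv.apply_symm_apply] at this
    tauto
  have key : ∀ x, Q x ∨ Q (turn.symm x) := by
    have not_even : ∀ {x}, ¬ Odd (cellLevel x) → ¬ Q x := fun hx ⟨h, _⟩ => hx h
    refine induction_turn_rot hyp (Or.inr ⟨odd_cellLevel_base, 1, by simp; rfl⟩) ?_ ?_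
    · intro x
      rw [Equiv.symm_apply_apply]
      by_cases hx : Odd (cellLevel x)
      · have h1 := not_even ((not_congr (odd_cellLevel_turn x)).2 (not_not.2 hx))
        have h2 := not_even ((not_congr (odd_turn_symm x)).2 (not_not.2 hx))
        tauto
      · have h1 := not_even hx
        have h2 := (odd_turn_symm x).2 hx
        have h3 := Q_face h2
        have h4 := Q_rot (((faceRot hyp).2.1 _).2 h2)
        rw [rot_faceRot, Equiv.apply_symm_apply] at h4
        tauto
    · intro x
      by_cases hx : Odd (cellLevel x)
      · have h1 := Q_rot hx
        have h2 := not_even ((not_congr (odd_turn_symm x)).2 (not_not.2 hx))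
        have h3 := not_even ((not_congr (odd_turn_symm (rot hyp x))).2
          (not_not.2 (by rwa [cellLevel_rot])))
        tauto
      · have h1 := not_even hx
        have h2 : ¬ Q (rot hyp x) := not_even (by rwa [cellLevel_rot])
        have h3 := Q_face ((odd_turn_symm x).2 hx)
        rw [show (faceRot hyp).1 (turn.symm x) = turn.symm (rot hyp x) from by
          change turn.symm (rot hyp (turn (turn.symm x))) = _
          rw [Equiv.apply_symm_apply]] at h3
        tauto
  rcases key x with ⟨_, h⟩ | ⟨h, -⟩
  · exact h
  · exact absurd hx ((odd_turn_symm x).1 h)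

lemma exists_groupElt_eq (hyp : IsHyperbolic p q) (g : FuchsianGroup p q) :
    ∃ x, Odd (cellLevel x) ∧ groupElt p q x = g := by
  obtain ⟨x, hx, h⟩ :=
    exists_toClass_eq (action hyp g⁻¹ (toClass p q base odd_cellLevel_base))
  refine ⟨x, hx, ?_⟩
  have h1 := classElt_action hyp g⁻¹ (toClass p q base odd_cellLevel_base)
  rw [← h] at h1
  change groupElt p q x = groupElt p q base * g⁻¹⁻¹ at h1
  rwa [groupElt_base, one_mul, inv_inv] at h1

/-- If `g` and `g'` carry the base class to those of `x` and `y`, the labels are `g⁻¹` and `g'⁻¹`.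
Equal labels thus force equal classes. -/
lemma exists_shift_eq_of_groupElt_eq (hyp : IsHyperbolic p q) {x y : Dart} (hx : Odd (cellLevel x))
    (hy : Odd (cellLevel y)) (h : groupElt p q x = groupElt p q y) :
    ∃ t, shift p q t x = y := by
  obtain ⟨g, hg⟩ := exists_action_base hyp x hx
  obtain ⟨g', hg'⟩ := exists_action_base hyp y hy
  have h1 := classElt_action hyp g (toClass p q base odd_cellLevel_base)
  have h2 := classElt_action hyp g' (toClass p q base odd_cellLevel_base)
  rw [hg] at h1
  rw [hg'] at h2
  change groupElt p q x = groupElt p q base * _ at h1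
  change groupElt p q y = groupElt p q base * _ at h2
  rw [h1, h2, mul_right_inj, inv_inj] at h
  rw [h, hg'] at hg
  exact Quotient.exact hg.symm

end Dart
-- Vertices, faces and layers of the tiling as cells of the model
namespace Dart

variable {p q : ℕ}

lemma coe_groupElt_rot_zpow (hyp : IsHyperbolic p q) {x : Dart} (hx : Odd (cellLevel x)) (k : ℤ) :
    (groupElt p q ((rot hyp ^ k) x) : Vertex p q) = groupElt p q x := by
  rw [groupElt_rot_zpow_of_odd hyp k hx, eq_comm, QuotientGroup.eq, inv_mul_cancel_left]
  exact ⟨k, rfl⟩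

lemma coe_groupElt_turn_symm_rot_zpow_turn (hyp : IsHyperbolic p q) {x : Dart}
    (hx : Odd (cellLevel x)) (k : ℤ) :
    (groupElt p q (turn.symm ((rot hyp ^ k) (turn x))) : Face p q) = groupElt p q x := by
  rw [(groupElt_turn_symm_rot_zpow_turn hyp k hx).2, eq_comm, QuotientGroup.eq, inv_mul_cancel_left]
  exact ⟨k, rfl⟩

/-- Two darts at the same vertex of the tiling belong to the same cell, up to full periods. -/
lemma exists_shift_rot_zpow_of_vertex_eq (hyp : IsHyperbolic p q) {x y : Dart}
    (hx : Odd (cellLevel x)) (hy : Odd (cellLevel y))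
    (h : (groupElt p q x : Vertex p q) = groupElt p q y) :
    ∃ (k t : ℤ), shift p q t ((rot hyp ^ k) x) = y := by
  obtain ⟨k, hk⟩ := QuotientGroup.eq.1 h
  refine ⟨k, exists_shift_eq_of_groupElt_eq hyp (by rwa [cellLevel_rot_zpow]) hy ?_⟩
  rw [groupElt_rot_zpow_of_odd hyp k hx]
  simp only at hk
  rw [hk, mul_inv_cancel_left]

lemma cellLevel_eq_of_vertex_eq (hyp : IsHyperbolic p q) {x y : Dart}
    (hx : Odd (cellLevel x)) (hy : Odd (cellLevel y))
    (h : (groupElt p q x : Vertex p q) = groupElt p q y) : cellLevel x = cellLevel y := by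
  obtain ⟨k, t, rfl⟩ := exists_shift_rot_zpow_of_vertex_eq hyp hx hy h
  rw [cellLevel_shift, cellLevel_rot_zpow]

/-- The face coset of a vertex dart `x` belongs to the cell of `turn x`. Passing within the coset
rotates about that cell and so preserves its level. -/
lemma cellLevel_turn_eq_of_face_eq (hyp : IsHyperbolic p q) {x y : Dart}
    (hx : Odd (cellLevel x)) (hy : Odd (cellLevel y))
    (h : (groupElt p q x : Face p q) = groupElt p q y) :
    cellLevel (turn x) = cellLevel (turn y) := by
  obtain ⟨k, hk⟩ := QuotientGroup.eq.1 h
  obtain ⟨h1, h2⟩ := groupElt_turn_symm_rot_zpow_turn hyp k hx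
  simp only at hk
  rw [hk, mul_inv_cancel_left] at h2
  obtain ⟨t, rfl⟩ := exists_shift_eq_of_groupElt_eq hyp h1 hy h2
  rw [turn_shift, Equiv.apply_symm_apply, cellLevel_shift, cellLevel_rot_zpow]

lemma incident_iff (hyp : IsHyperbolic p q) {v : Vertex p q} {f : Face p q} : Incident v f ↔
    ∃ x, Odd (cellLevel x) ∧ (groupElt p q x : Vertex p q) = v ∧ (groupElt p q x : Face p q) = f := by
  constructor
  · rintro ⟨g, hv, hf⟩
    obtain ⟨x, hx, rfl⟩ := exists_groupElt_eq hyp g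
    exact ⟨x, hx, hv, hf⟩
  · rintro ⟨x, -, hv, hf⟩
    exact ⟨_, hv, hf⟩

lemma exists_rot_zpow_eq_right (hyp : IsHyperbolic p q) {x : Dart} {m : ℕ}
    (hx : cellLevel x = m + 1) : ∃ k : ℤ, (rot hyp ^ k) x = ⟨m, cellPos p q x, .right⟩ := by
  obtain ⟨n, hn⟩ := exists_rot_pow_eq hyp hx
  refine ⟨-n, ?_⟩
  rw [zpow_neg, zpow_natCast, Equiv.Perm.inv_eq_iff_eq]
  exact hn.symm

lemma exists_cellLevel_turn_symm_rot_zpow (hyp : IsHyperbolic p q) {x : Dart} {m : ℕ}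
    (hx : cellLevel x = m + 1) : ∃ k : ℤ, cellLevel (turn.symm ((rot hyp ^ k) x)) = m := by
  obtain ⟨k, hk⟩ := exists_rot_zpow_eq_right hyp hx
  exact ⟨k, by rw [hk]; rfl⟩

/-- Companion of the previous lemma, ending at the right edge instead of the left one: a vertex dart
reaches its face by `turn`, while a face dart reaches its vertex by `turn.symm`. -/
lemma exists_cellLevel_turn_rot_zpow (hyp : IsHyperbolic p q) {x : Dart} {m : ℕ}
    (hx : cellLevel x = m + 1) : ∃ k : ℤ, cellLevel (turn ((rot hyp ^ k) x)) = m := by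
  obtain ⟨k, hk⟩ := exists_rot_zpow_eq_right hyp hx
  obtain ⟨n, hn⟩ := exists_eq_above_add hyp m (cellPos p q x)
  refine ⟨(n + 1 : ℕ) + k, ?_⟩
  rw [zpow_add, Equiv.Perm.mul_apply, hk, zpow_natCast, rot_pow_right_eq_left hyp n hn]
  rfl

/-- Incident cells differ in level by exactly one, so vertices on a common face differ by 0 or 2 in
`cellLevel`; excluding the earlier layers leaves only the step up. Conversely every cell other than
the fundamental face touches one of the next lower level, and two such descents lead from a vertex
to the preceding layer. -/
theorem layer_eq (hyp : IsHyperbolic p q) (n : ℕ) :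
    layer p q n = {v | ∃ x, cellLevel x = 2 * n + 1 ∧ (groupElt p q x : Vertex p q) = v} := by
  have odd_of_eq : ∀ {x : Dart} {n : ℕ}, cellLevel x = 2 * n + 1 → Odd (cellLevel x) :=
    fun h => ⟨_, h⟩
  induction n using Nat.strong_induction_on with
  | _ n ih =>
  rcases n with _ | n
  · ext v
    rw [layer_zero]
    change Incident v (baseFace p q) ↔ _
    rw [incident_iff hyp]
    constructor
    · rintro ⟨x, hx, rfl, hf⟩
      refine ⟨x, ?_, rfl⟩
      have hb : (groupElt p q x : Face p q) = groupElt p q base := by rw [hf, groupElt_base]; rfl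
      have h1 := cellLevel_turn_eq_of_face_eq hyp hx odd_cellLevel_base hb
      have h2 := cellLevel_turn x
      have h3 : cellLevel (turn base) = 0 := rfl
      omega
    · rintro ⟨x, hx, rfl⟩
      obtain ⟨k, hk⟩ := exists_cellLevel_turn_rot_zpow hyp hx
      have hodd : Odd (cellLevel ((rot hyp ^ k) x)) := by
        rw [cellLevel_rot_zpow]; exact odd_of_eq hx
      refine ⟨(rot hyp ^ k) x, hodd, coe_groupElt_rot_zpow hyp (odd_of_eq hx) k, ?_⟩
      rw [← groupElt_turn hodd]
      generalize turn ((rot hyp ^ k) x) = y at hk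
      obtain ⟨m, i, _ | _ | _ | _⟩ := y
      · simp [cellLevel] at hk
      · simp [cellLevel] at hk
      · simp [cellLevel] at hk
      · obtain rfl : m = 0 := hk
        rw [baseFace, eq_comm, QuotientGroup.eq, inv_one, one_mul]
        exact ⟨i, rfl⟩
  · ext w
    rw [layer_succ]
    constructor
    · rintro ⟨⟨v, hv, f, hvf, hwf⟩, hw⟩
      rw [ih n (by omega)] at hv
      obtain ⟨x, hx, rfl⟩ := hv
      obtain ⟨y, hy, hyv, hyf⟩ := (incident_iff hyp).1 hvf
      obtain ⟨z, hz, rfl, hzf⟩ := (incident_iff hyp).1 hwf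
      refine ⟨z, ?_, rfl⟩
      have h1 := cellLevel_eq_of_vertex_eq hyp hy (odd_of_eq hx) hyv
      have h2 := cellLevel_turn_eq_of_face_eq hyp hy hz (hyf.trans hzf.symm)
      have h3 := cellLevel_turn y
      have h4 := cellLevel_turn z
      have h5 : ∀ m ≤ n, cellLevel z ≠ 2 * m + 1 := fun m hm hzm => by
        refine hw m hm ?_
        rw [ih m (by omega)]
        exact ⟨z, hzm, rfl⟩
      obtain ⟨m, hm⟩ := hz
      have h6 : ¬ m ≤ n := fun h => h5 m h hm
      omega
    · rintro ⟨x, hx, rfl⟩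
      refine ⟨?_, fun m hm hmem => ?_⟩
      · obtain ⟨k, hk⟩ := exists_cellLevel_turn_rot_zpow hyp hx
        have hodd : Odd (cellLevel ((rot hyp ^ k) x)) := by
          rw [cellLevel_rot_zpow]; exact odd_of_eq hx
        obtain ⟨l, hl⟩ := exists_cellLevel_turn_symm_rot_zpow hyp
          (show cellLevel (turn ((rot hyp ^ k) x)) = (2 * n + 1) + 1 by omega)
        refine ⟨(groupElt p q (turn.symm ((rot hyp ^ l) (turn ((rot hyp ^ k) x)))) : Vertex p q),
          ?_, groupElt p q ((rot hyp ^ k) x), ?_, ?_⟩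
        · rw [ih n (by omega)]
          exact ⟨_, hl, rfl⟩
        · exact ⟨_, rfl, coe_groupElt_turn_symm_rot_zpow_turn hyp hodd l⟩
        · exact ⟨_, coe_groupElt_rot_zpow hyp (odd_of_eq hx) k, rfl⟩
      · rw [ih m (by omega)] at hmem
        obtain ⟨y, hy, hyx⟩ := hmem
        have := cellLevel_eq_of_vertex_eq hyp (odd_of_eq hy) (odd_of_eq hx) hyx
        omega

/-- The vertex of a cell of even level. -/
noncomputable def cellVertex (p q n : ℕ) (i : ℤ) : Vertex p q :=
  groupElt p q ⟨2 * n, i, .right⟩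

theorem layer_eq_image (hyp : IsHyperbolic p q) (n : ℕ) :
    layer p q n = cellVertex p q n '' Set.Ico 0 (period p q (2 * n)) := by
  have hN := hyp.period_pos (2 * n)
  rw [layer_eq hyp]
  ext v
  constructor
  · rintro ⟨x, hx, rfl⟩
    obtain ⟨k, hk⟩ := exists_rot_zpow_eq_right hyp hx
    refine ⟨cellPos p q x % period p q (2 * n), ⟨Int.emod_nonneg _ hN.ne', Int.emod_lt_of_pos _ hN⟩,
      ?_⟩
    rw [← coe_groupElt_rot_zpow hyp ⟨n, hx⟩ k, hk, cellVertex, groupElt, groupElt,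
      ← elt_shift hyp (rotFace_pow p q) (rotVertex_pow p q) (rotFace_mul_rotVertex_sq p q)
        (cellPos p q x / period p q (2 * n)), shift, Int.emod_add_ediv_mul]
  · rintro ⟨i, -, rfl⟩
    exact ⟨_, rfl, rfl⟩

/-- Rotation about a vertex keeps `cellPos` and a shift changes it by a multiple of the period, so
the position modulo the period is an invariant of the vertex. -/
theorem injOn_cellVertex (hyp : IsHyperbolic p q) (n : ℕ) :
    Set.InjOn (cellVertex p q n) (Set.Ico 0 (period p q (2 * n))) := by
  rintro i ⟨hi0, hi⟩ j ⟨hj0, hj⟩ h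
  obtain ⟨k, t, hkt⟩ := exists_shift_rot_zpow_of_vertex_eq hyp (x := ⟨2 * n, i, .right⟩)
    (y := ⟨2 * n, j, .right⟩) ⟨n, rfl⟩ ⟨n, rfl⟩ h
  have h1 := congrArg (cellPos p q) hkt
  rw [cellPos_shift hyp (m := 2 * n) (by rw [cellLevel_rot_zpow]; rfl), cellPos_rot_zpow] at h1
  change i + t * period p q (2 * n) = j at h1
  rw [← Int.emod_eq_of_lt hi0 hi, ← Int.emod_eq_of_lt hj0 hj, ← h1, Int.add_mul_emod_self_right]

theorem finite_layer (hyp : IsHyperbolic p q) (n : ℕ) : (layer p q n).Finite := by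
  rw [layer_eq_image hyp]
  exact (Set.finite_Ico _ _).image _

theorem ncard_layer (hyp : IsHyperbolic p q) (n : ℕ) :
    ((layer p q n).ncard : ℤ) = period p q (2 * n) := by
  have hN := hyp.period_pos (2 * n)
  rw [layer_eq_image hyp, (injOn_cellVertex hyp n).ncard_image, ← Finset.coe_Ico,
    Set.ncard_coe_finset, Int.card_Ico]
  omega

end Dart

/-! ### The linear recurrence, closed forms and eigenvalues -/

section
variable {p q : ℕ}

/-- Elimination of the face levels from three consecutive instances of the recursion. -/
lemma period_even_add_four (n : ℕ) : period p q (2 * (n + 2)) =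
    (((p : ℤ) - 2) * ((q : ℤ) - 2) - 2) * period p q (2 * (n + 1)) - period p q (2 * n) := by
  have h1 : period p q (2 * n + 2) =
      ((p : ℤ) - 2) * period p q (2 * n + 1) - period p q (2 * n) := by
    rw [period, excess, if_neg (by simp)]
  have h2 : period p q (2 * n + 1 + 2) =
      ((q : ℤ) - 2) * period p q (2 * n + 2) - period p q (2 * n + 1) := by
    rw [period, excess, if_pos (by simp [Nat.even_add_one])]
  have h3 : period p q (2 * n + 2 + 2) =
      ((p : ℤ) - 2) * period p q (2 * n + 1 + 2) - period p q (2 * n + 2) := by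
    rw [period, excess, if_neg (by simp [Nat.even_add_one])]
  change period p q (2 * n + 2 + 2) = _ * period p q (2 * n + 2) - _
  linear_combination h3 + ((p : ℤ) - 2) * h2 + h1

lemma period_two : period p q 2 = ((p : ℤ) - 2) * (((q : ℤ) - 2) * p) - p := by
  simp [period, excess]

end

/-- A sequence satisfying a second order linear recursion is determined by two values and by the
roots of the characteristic polynomial. -/
lemma eq_of_recurrence {u : ℕ → ℝ} {t C D l m : ℝ} (hu : ∀ n, u (n + 2) = t * u (n + 1) - u n)
    (hl : l ^ 2 = t * l - 1) (hm : m ^ 2 = t * m - 1) (h0 : u 0 = C + D)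
    (h1 : u 1 = C * l + D * m) (n : ℕ) : u n = C * l ^ n + D * m ^ n := by
  induction n using Nat.twoStepInduction with
  | zero => simpa using h0
  | one => simpa using h1
  | more n ih1 ih2 =>
    rw [hu, ih1, ih2]
    linear_combination (-C * l ^ n) * hl - D * m ^ n * hm

lemma hasEigenvalue_toLin'_fin_two_iff (M : Matrix (Fin 2) (Fin 2) ℝ) (l m μ : ℝ)
    (htr : M 0 0 + M 1 1 = l + m) (hdet : M 0 0 * M 1 1 - M 0 1 * M 1 0 = l * m) :
    Module.End.HasEigenvalue (Matrix.toLin' M) μ ↔ μ = l ∨ μ = m := by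
  rw [Module.End.hasEigenvalue_iff_isRoot_charpoly, Matrix.charpoly_toLin', Polynomial.IsRoot,
    Matrix.charpoly_fin_two, Matrix.trace_fin_two, Matrix.det_fin_two, htr, hdet]
  simp only [Polynomial.eval_add, Polynomial.eval_sub, Polynomial.eval_pow, Polynomial.eval_mul,
    Polynomial.eval_X, Polynomial.eval_C]
  rw [show μ ^ 2 - (l + m) * μ + l * m = (μ - l) * (μ - m) by ring, mul_eq_zero, sub_eq_zero,
    sub_eq_zero]

lemma lamPlus_add_lamMinus (p q : ℝ) :
    lamPlus p q + lamMinus p q = (p - 2) * (q - 2) - 2 := by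
  unfold lamPlus lamMinus; ring

lemma lamPlus_mul_lamMinus {p q : ℝ} (h : 0 ≤ (p - 2) * (q - 2) * (q * (p - 2) - 2 * p)) :
    lamPlus p q * lamMinus p q = 1 := by
  unfold lamPlus lamMinus
  linear_combination (-1 / 4) * Real.sq_sqrt h

theorem coeff_growthSeries {p q : ℕ} (hyp : IsHyperbolic p q) (n : ℕ) :
    PowerSeries.coeff n (growthSeries p q) = (period p q (2 * n) : ℝ) := by
  rw [growthSeries, PowerSeries.coeff_mk, ← Dart.ncard_layer hyp]
  simp

lemma IsHyperbolic.discr_pos {p q : ℕ} (hyp : IsHyperbolic p q) :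
    (0 : ℝ) < p - 2 ∧ (0 : ℝ) < q - 2 ∧ (0 : ℝ) < p * (q - 2) - 2 * q := by
  obtain ⟨h1, h2, h3⟩ := hyp
  have h1 : (3 : ℝ) ≤ p := by exact_mod_cast h1
  have h2 : (3 : ℝ) ≤ q := by exact_mod_cast h2
  have h3 : (4 : ℝ) < ((p : ℝ) - 2) * ((q : ℝ) - 2) := by exact_mod_cast h3
  exact ⟨by linarith, by linarith, by linarith⟩

lemma coeff_growthSeries_add_two {p q : ℕ} (hyp : IsHyperbolic p q) (n : ℕ) :
    PowerSeries.coeff (n + 2) (growthSeries p q) =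
      (((p : ℝ) - 2) * ((q : ℝ) - 2) - 2) * PowerSeries.coeff (n + 1) (growthSeries p q) -
        PowerSeries.coeff n (growthSeries p q) := by
  rw [coeff_growthSeries hyp, coeff_growthSeries hyp, coeff_growthSeries hyp, period_even_add_four]
  push_cast
  ring

lemma coeff_zero_growthSeries {p q : ℕ} (hyp : IsHyperbolic p q) :
    PowerSeries.coeff 0 (growthSeries p q) = p := by
  rw [coeff_growthSeries hyp]
  simp [period]

lemma coeff_one_growthSeries {p q : ℕ} (hyp : IsHyperbolic p q) :
    PowerSeries.coeff 1 (growthSeries p q) = ((p : ℝ) - 2) * ((q - 2) * p) - p := by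
  rw [coeff_growthSeries hyp, mul_one, period_two]
  push_cast
  ring

lemma lamPlus_sub_lamMinus {p q : ℝ} :
    lamPlus p q - lamMinus p q = √((p - 2) * (q - 2) * (q * (p - 2) - 2 * p)) := by
  unfold lamPlus lamMinus; ring

/-- Since `q * (p - 2) - 2 * p = p * (q - 2) - 2 * q`, the root in `λ±` factors as `s * r` with `r =
√(q - 2)`, while `C± = s ± (p - 2) * r` and `cConst = p / (2 * s)`. The two initial values then
reduce to the sum and difference of `λ±`. -/
theorem coeff_growthSeries_eq {p q : ℕ} (hyp : IsHyperbolic p q) (n : ℕ) :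
    PowerSeries.coeff n (growthSeries p q) =
      cConst p q * (CPlus p q * lamPlus p q ^ n + CMinus p q * lamMinus p q ^ n) := by
  obtain ⟨h1, h2, h3⟩ := hyp.discr_pos
  have hs : (0 : ℝ) < √((p - 2) * (p * (q - 2) - 2 * q)) := Real.sqrt_pos.2 (mul_pos h1 h3)
  have hr : √((q : ℝ) - 2) ^ 2 = q - 2 := Real.sq_sqrt h2.le
  have hd : ((p : ℝ) - 2) * (q - 2) * (q * (p - 2) - 2 * p) =
      (p - 2) * (p * (q - 2) - 2 * q) * (q - 2) := by ring
  have hsum := lamPlus_add_lamMinus p q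
  have hprod : lamPlus p q * lamMinus p q = 1 :=
    lamPlus_mul_lamMinus (by rw [hd]; positivity)
  have hdiff : lamPlus p q - lamMinus p q =
      √(((p : ℝ) - 2) * (p * (q - 2) - 2 * q)) * √((q : ℝ) - 2) := by
    rw [lamPlus_sub_lamMinus, hd, Real.sqrt_mul (mul_pos h1 h3).le]
  have key := eq_of_recurrence (u := fun n => PowerSeries.coeff n (growthSeries p q))
    (C := cConst p q * CPlus p q) (D := cConst p q * CMinus p q)
    (l := lamPlus p q) (m := lamMinus p q)
    (coeff_growthSeries_add_two hyp)
    (by linear_combination lamPlus p q * hsum - hprod)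
    (by linear_combination lamMinus p q * hsum - hprod) ?_ ?_ n
  · rw [key]; ring
  · simp only [coeff_zero_growthSeries hyp, cConst, CPlus, CMinus]
    field_simp
    ring
  · simp only [coeff_one_growthSeries hyp, cConst, CPlus, CMinus]
    have hne := hs.ne'
    set s := √(((p : ℝ) - 2) * (p * (q - 2) - 2 * q))
    set r := √((q : ℝ) - 2)
    rw [div_mul_eq_mul_div, div_mul_eq_mul_div, div_mul_eq_mul_div, div_mul_eq_mul_div, ← add_div,
      eq_div_iff (by positivity)]
    linear_combination (-(p : ℝ) * s) * hsum - (p : ℝ) * (p - 2) * r * hdiff -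
      (p : ℝ) * (p - 2) * s * hr

/-- The same recurrence started at index 1, so that the initial values to match are `a 1` and `a 2 =
(q - 4) * a 1 - a 0`. -/
theorem coeff_growthSeries_triangle {q : ℕ} (hyp : IsHyperbolic 3 q) (n : ℕ) :
    PowerSeries.coeff (n + 1) (growthSeries 3 q) =
      CTildePlus q * lamPlus (3 : ℕ) q ^ n + CTildeMinus q * lamMinus (3 : ℕ) q ^ n := by
  obtain ⟨-, h2, h3⟩ := hyp.discr_pos
  have h3 : (0 : ℝ) < q - 6 := by push_cast at h3; linarith
  have hd : (((3 : ℕ) : ℝ) - 2) * (q - 2) * (q * ((3 : ℕ) - 2) - 2 * (3 : ℕ)) =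
      (q - 6) * (q - 2) := by push_cast; ring
  have hs : (0 : ℝ) < √(((q : ℝ) - 6) * (q - 2)) := Real.sqrt_pos.2 (mul_pos h3 h2)
  have hsum := lamPlus_add_lamMinus (3 : ℕ) q
  have hprod : lamPlus (3 : ℕ) q * lamMinus (3 : ℕ) q = 1 :=
    lamPlus_mul_lamMinus (by rw [hd]; positivity)
  have hdiff : lamPlus (3 : ℕ) q - lamMinus (3 : ℕ) q = √(((q : ℝ) - 6) * (q - 2)) := by
    rw [lamPlus_sub_lamMinus, hd]
  refine eq_of_recurrence (u := fun n => PowerSeries.coeff (n + 1) (growthSeries 3 q))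
    (fun n => coeff_growthSeries_add_two hyp (n + 1))
    (by linear_combination lamPlus (3 : ℕ) q * hsum - hprod)
    (by linear_combination lamMinus (3 : ℕ) q * hsum - hprod) ?_ ?_ n
  · simp only [zero_add, coeff_one_growthSeries hyp, CTildePlus, CTildeMinus]
    push_cast
    ring
  · change PowerSeries.coeff (0 + 2) (growthSeries 3 q) = _
    rw [coeff_growthSeries_add_two hyp, zero_add, coeff_one_growthSeries hyp,
      coeff_zero_growthSeries hyp]
    simp only [CTildePlus, CTildeMinus]
    have hdiv : √(((q : ℝ) - 6) * (q - 2)) / √(((q : ℝ) - 6) * (q - 2)) = 1 := div_self hs.ne'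
    generalize lamPlus (3 : ℕ) (q : ℝ) = l at hsum hdiff ⊢
    generalize lamMinus (3 : ℕ) (q : ℝ) = m at hsum hdiff ⊢
    generalize √(((q : ℝ) - 6) * (q - 2)) = s at hdiff hdiv ⊢
    push_cast at hsum ⊢
    rw [div_eq_mul_inv] at hdiv ⊢
    linear_combination (-(3 / 2 : ℝ) * (q - 3)) * hsum -
      (3 / 2 : ℝ) * (q - 5) * (q - 2) * s⁻¹ * hdiff - (3 / 2 : ℝ) * (q - 5) * (q - 2) * hdiv

end HypLattice

theorem mainTheorem4 (p q : ℕ) (hp : 0 < p) (hq : 0 < q)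
    (hpq : (1 : ℝ) / p + (1 : ℝ) / q < 1 / 2) :
    (∀ n : ℕ, (HypLattice.layer p q n).Finite) ∧
    (4 ≤ p →
      (∀ n : ℕ, PowerSeries.coeff n (HypLattice.growthSeries p q) =
        HypLattice.cConst p q *
          (HypLattice.CPlus p q * HypLattice.lamPlus p q ^ n +
            HypLattice.CMinus p q * HypLattice.lamMinus p q ^ n)) ∧
      (∀ μ : ℝ, Module.End.HasEigenvalue
          (Matrix.toLin' (HypLattice.transferMatrix p q)) μ ↔
        μ = HypLattice.lamPlus p q ∨ μ = HypLattice.lamMinus p q)) ∧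
    (p = 3 →
      PowerSeries.coeff 0 (HypLattice.growthSeries p q) = 3 ∧
      (∀ n : ℕ, 1 ≤ n → PowerSeries.coeff n (HypLattice.growthSeries p q) =
        HypLattice.CTildePlus q * HypLattice.lamPlus p q ^ (n - 1) +
          HypLattice.CTildeMinus q * HypLattice.lamMinus p q ^ (n - 1)) ∧
      (∀ μ : ℝ, Module.End.HasEigenvalue
          (Matrix.toLin' (HypLattice.transferMatrixTri q)) μ ↔
        μ = HypLattice.lamPlus p q ∨ μ = HypLattice.lamMinus p q)) := by
  have hyp := HypLattice.isHyperbolic_of_lt hp hq hpq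
  have hprod : HypLattice.lamPlus p q * HypLattice.lamMinus p q = 1 := by
    obtain ⟨h1, h2, h3⟩ := hyp.discr_pos
    refine HypLattice.lamPlus_mul_lamMinus ?_
    rw [show (q : ℝ) * (p - 2) - 2 * p = p * (q - 2) - 2 * q by ring]
    positivity
  have hsum := HypLattice.lamPlus_add_lamMinus p q
  refine ⟨HypLattice.Dart.finite_layer hyp, fun _ =>
    ⟨HypLattice.coeff_growthSeries_eq hyp, fun μ => ?_⟩, ?_⟩
  · refine HypLattice.hasEigenvalue_toLin'_fin_two_iff _ _ _ _ ?_ ?_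
    · rw [hsum]; simp [HypLattice.transferMatrix]; ring
    · rw [hprod]; simp [HypLattice.transferMatrix]; ring
  · rintro rfl
    refine ⟨by rw [HypLattice.coeff_zero_growthSeries hyp]; norm_num, fun n hn => ?_, fun μ => ?_⟩
    · obtain ⟨n, rfl⟩ := Nat.exists_eq_add_of_le' hn
      exact HypLattice.coeff_growthSeries_triangle hyp n
    · refine HypLattice.hasEigenvalue_toLin'_fin_two_iff _ _ _ _ ?_ ?_
      · rw [hsum]; simp [HypLattice.transferMatrixTri]; ring
      · rw [hprod]; simp [HypLattice.transferMatrixTri]; norm_num
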